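/- Let $A$ be a self-adjoint operator on a complex Hilbert space $H$, with domain $D(A)$ and powers $A^j$ with domains $D(A^j)$ ($D(A^0)=H$), and let $N\ge 1$ be an integer. Let $J:H\to H$ be a (nonlinear) mapping with $J(D(A^j))\subset D(A^j)$ for $0\le j\le N$ such that, for all $\varphi,\psi\in D(A^N)$, with finite constants $C(\cdot)$ (which may depend on $j$) that are monotonically increasing functions of the norms indicated, 1. $\|J(\varphi)\|\le C(\|\varphi\|)\,\|\varphi\|$; 2. $\|A^jJ(\varphi)\|\le C(\|\varphi\|,\dots,\|A^{j-1}\varphi\|)\,\|A^j\varphi\|$ for $1\le j\le N$; 3. $\|A^j(J(\varphi)-J(\psi))\|\le C(\|\varphi\|,\|\psi\|,\dots,\|A^j\varphi\|,\|A^j\psi\|)\,\|A^j(\varphi-\psi)\|$ for $0\le j\le N$. Let $\Theta$ be a function on a complex vector space $E$ (a complexified test function space) whose values are bounded linear operators on $H$, let $\zeta,\eta\in E$ and $z\in\mathbb C$, and suppose that $B=\Theta(\zeta+z\eta)$ maps $D(A^j)$ into itself and satisfies $\|A^jB\varphi\|\le K_j\|A^j\varphi\|$ for all $\varphi\in D(A^N)$,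 for $0\le j\le N$. (This holds automatically if $\Theta$ is complex-valued and acts by multiplication.) Let $\varphi_0\in D(A^N)$ and consider $$\frac{d\varphi}{dt}=-iA\varphi+J(\varphi)+\Theta(\zeta+z\eta)\varphi,\qquad \varphi(0)=\varphi_0. \tag{$*$}$$ A strong solution on $[0,T)$, $0<T\le\infty$, is a function $\varphi$ on $[0,T)$ with values in $D(A^N)$, continuous for the graph norm $\sum_{j=0}^N\|A^j\varphi\|$, that is strongly differentiable in $H$ (one-sidedly at $0$) and satisfies $(*)$. Suppose that for every finite $T>0$ and every strong solution $\varphi$ of $(*)$ on $[0,T)$ the norm $\|\varphi(t)\|$ is bounded on $[0,T)$. Then the strong solution exists globally in time: there is a strong solution $\varphi$ of $(*)$ on $[0,\infty)$ (in particular $\varphi(t)\in D(A^N)$ for all $t\ge 0$), it satisfies the mild equation $$\varphi(t)=e^{-itA}\varphi_0+\int_0^te^{-i(t-s)A}J(\varphi(s))\,ds+\int_0^te^{-i(t-s)A}\,\Theta(\zeta+z\eta)\varphi(s)\,ds,\qquad t\ge 0,$$ and every strong solution of $(*)$ on an interval $[0,T)$ with $0<T<\infty$ coincides with $\varphi$ on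 $[0,T)$. -/

import Mathlib

open scoped InnerProductSpace

noncomputable section

namespace SemilinearEvolution

variable {H : Type*} [NormedAddCommGroup H] [InnerProductSpace ℂ H]

/-- The composition `S ∘ T` of two partially defined operators, on its natural domain
`{x ∈ D(T) | T x ∈ D(S)}`. -/
def compOp (S T : H →ₗ.[ℂ] H) : H →ₗ.[ℂ] H :=
  S.comp (T.domRestrict ((S.domain.comap T.toFun).map T.domain.subtype)) (by
    intro x
    obtain ⟨y, hy, hyx⟩ := Submodule.mem_map.1 (Submodule.mem_inf.1 x.2).1
    rw [LinearPMap.domRestrict_apply (x := x) (y := y) hyx.symm]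
    exact hy)

/-- The power `A ^ j` of a partially defined operator, with `D(A ^ 0) = H` and
`D(A ^ (j + 1)) = {x ∈ D(A ^ j) | A ^ j x ∈ D(A)}`. -/
def powOp (A : H →ₗ.[ℂ] H) : ℕ → (H →ₗ.[ℂ] H)
  | 0 => (LinearMap.id : H →ₗ[ℂ] H).toPMap ⊤
  | j + 1 => compOp A (powOp A j)

open Classical in
/-- The value `T x` for `x ∈ D(T)`. (The value `0` off the domain is never used: below, `ev T x`
occurs only where `x ∈ D(T)` is known.) -/
def ev (T : H →ₗ.[ℂ] H) (x : H) : H := if h : x ∈ T.domain then T ⟨x, h⟩ else 0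

/-- The assumptions on the nonlinearity `J`: it maps `D(A ^ j)` to itself for `0 ≤ j ≤ N`, and
for all `φ, ψ ∈ D(A ^ N)`, with real-valued monotonically increasing functions `C`,
* `‖J φ‖ ≤ C(‖φ‖) ‖φ‖`;
* `‖A ^ j J φ‖ ≤ C(‖φ‖, …, ‖A ^ (j - 1) φ‖) ‖A ^ j φ‖` for `1 ≤ j ≤ N`;
* `‖A ^ j (J φ - J ψ)‖ ≤ C(‖φ‖, ‖ψ‖, …, ‖A ^ j φ‖, ‖A ^ j ψ‖) ‖A ^ j (φ - ψ)‖`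
  for `0 ≤ j ≤ N`. -/
structure IsAdmissibleNonlinearity (A : H →ₗ.[ℂ] H) (N : ℕ) (J : H → H) : Prop where
  mapsTo : ∀ j ≤ N, ∀ φ ∈ (powOp A j).domain, J φ ∈ (powOp A j).domain
  growth_zero : ∃ C : ℝ → ℝ, Monotone C ∧
    ∀ φ ∈ (powOp A N).domain, ‖J φ‖ ≤ C ‖φ‖ * ‖φ‖
  growth : ∀ j, 1 ≤ j → j ≤ N → ∃ C : (Fin j → ℝ) → ℝ, Monotone C ∧
    ∀ φ ∈ (powOp A N).domain,
      ‖ev (powOp A j) (J φ)‖ ≤ C (fun k => ‖ev (powOp A k) φ‖) * ‖ev (powOp A j) φ‖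
  lipschitz : ∀ j ≤ N, ∃ C : (Fin (j + 1) → ℝ) × (Fin (j + 1) → ℝ) → ℝ, Monotone C ∧
    ∀ φ ∈ (powOp A N).domain, ∀ ψ ∈ (powOp A N).domain,
      ‖ev (powOp A j) (J φ - J ψ)‖ ≤
        C (fun k => ‖ev (powOp A k) φ‖, fun k => ‖ev (powOp A k) ψ‖) *
          ‖ev (powOp A j) (φ - ψ)‖

/-- A bounded operator `B` that maps `D(A ^ j)` to itself with `‖A ^ j B φ‖ ≤ K ‖A ^ j φ‖` on
`D(A ^ N)`, for `0 ≤ j ≤ N`. Every scalar operator `φ ↦ θ φ`, `θ ∈ ℂ`, is of this kind. -/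
structure IsAdmissiblePotential (A : H →ₗ.[ℂ] H) (N : ℕ) (B : H →L[ℂ] H) : Prop where
  mapsTo : ∀ j ≤ N, ∀ φ ∈ (powOp A j).domain, B φ ∈ (powOp A j).domain
  bound : ∀ j ≤ N, ∃ K : ℝ, ∀ φ ∈ (powOp A N).domain,
    ‖ev (powOp A j) (B φ)‖ ≤ K * ‖ev (powOp A j) φ‖

theorem isAdmissiblePotential_scalar (A : H →ₗ.[ℂ] H) (N : ℕ) (θ : ℂ) :
    IsAdmissiblePotential A N (θ • ContinuousLinearMap.id ℂ H) where
  mapsTo j _ φ hφ := (powOp A j).domain.smul_mem θ hφ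
  bound j _ := by
    refine ⟨‖θ‖, fun φ _ => ?_⟩
    by_cases h : φ ∈ (powOp A j).domain
    · have h' : θ • φ ∈ (powOp A j).domain := (powOp A j).domain.smul_mem θ h
      have e : (powOp A j) ⟨θ • φ, h'⟩ = θ • (powOp A j) ⟨φ, h⟩ :=
        (powOp A j).map_smul θ ⟨φ, h⟩
      simp [ev, h, h', e, norm_smul]
    · rcases eq_or_ne θ 0 with rfl | hθ
      · have e : (powOp A j) ⟨0, (powOp A j).domain.zero_mem⟩ = 0 := (powOp A j).map_zero
        simp [ev, e]
      · have h' : θ • φ ∉ (powOp A j).domain := fun h' =>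
          h (((powOp A j).domain.smul_mem_iff hθ).1 h')
        simp [ev, h, h']

/-- Strong solutions on the time interval `I` (which is `[0, T)` or `[0, ∞)` below) of
`φ' = - i A φ + J(φ) + B φ`, `φ(0) = φ₀`: the function `φ` is continuous with values in `D(A ^ N)`
(graph norm), strongly differentiable in `H` (one-sidedly at `0`), and satisfies the equation. -/
structure IsStrongSolution (A : H →ₗ.[ℂ] H) (N : ℕ) (J : H → H) (B : H →L[ℂ] H) (φ₀ : H)
    (I : Set ℝ) (φ : ℝ → H) : Prop where
  init : φ 0 = φ₀
  mem_domain : ∀ t ∈ I, φ t ∈ (powOp A N).domain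
  continuousOn : ∀ j ≤ N, ContinuousOn (fun t => ev (powOp A j) (φ t)) I
  hasDeriv : ∀ t ∈ I,
    HasDerivWithinAt φ (-(Complex.I • ev A (φ t)) + J (φ t) + B (φ t)) I t

/-- `U t = e ^ (- i t A)`: the strongly continuous one-parameter group of isometries of `H` whose
infinitesimal generator is exactly `- i A`. -/
structure IsPropagator (A : H →ₗ.[ℂ] H) (U : ℝ → H →L[ℂ] H) : Prop where
  zero : U 0 = ContinuousLinearMap.id ℂ H
  add : ∀ s t, U (s + t) = (U s).comp (U t)
  norm_map : ∀ t x, ‖U t x‖ = ‖x‖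
  continuous : ∀ x, Continuous fun t => U t x
  mem_domain_iff : ∀ x, x ∈ A.domain ↔ DifferentiableAt ℝ (fun t => U t x) 0
  hasDeriv : ∀ x ∈ A.domain, HasDerivAt (fun t => U t x) (-(Complex.I • ev A x)) 0

/-- Mild solutions on the time interval `I`:
`φ(t) = e^{-itA} φ₀ + ∫₀ᵗ e^{-i(t-s)A} J(φ(s)) ds + ∫₀ᵗ e^{-i(t-s)A} B φ(s) ds`. -/
def IsMildSolution (A : H →ₗ.[ℂ] H) (J : H → H) (B : H →L[ℂ] H) (φ₀ : H)
    (I : Set ℝ) (φ : ℝ → H) : Prop :=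
  ∃ U : ℝ → H →L[ℂ] H, IsPropagator A U ∧ ∀ t ∈ I,
    IntervalIntegrable (fun s => U (t - s) (J (φ s))) MeasureTheory.volume 0 t ∧
    IntervalIntegrable (fun s => U (t - s) (B (φ s))) MeasureTheory.volume 0 t ∧
    φ t = U t φ₀ + (∫ s in (0 : ℝ)..t, U (t - s) (J (φ s))) +
      ∫ s in (0 : ℝ)..t, U (t - s) (B (φ s))

end SemilinearEvolution

end

/-! In the interaction picture `v(t) = e^{itA} φ(t)` the unbounded term disappears and the equation
becomes `v' = e^{itA} F(e^{-itA} v)` with `F = J + Θ(ζ + zη)`. On `D(A^N)` with its graph norm,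
realised as the closed subspace `graphSpace` of `H^{N+1}`, this is an ordinary differential equation
in a Banach space. The group is isometric and commutes with every `A^j`, so the field is continuous
in time and Lipschitz on balls uniformly in time (`lipschitzOnWith_interactionField`). By
Picard-Lindelöf the solution continues as long as its graph norm stays bounded
(`exists_isIntegralCurveOn_Ici_of_bounded`).

The hypothesis bounds only `‖φ‖`. The growth condition for `A^j J` has a constant depending only on
the seminorms of order below `j`, so the bound climbs from order `j - 1` to order `j` by a linear
Gronwall estimate (`exists_bound_of_isIntegralCurveOn`).

Strong solutions are differentiable only in `H`, so uniqueness is proved in `H`, from the Lipschitz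
condition of order `0` on `D(A^N)`. The mild equation is the fundamental theorem of calculus for
`e^{isA} φ(s)`. The group itself comes from Stone's theorem (`exists_isPropagator`), obtained as a
limit of exponentials of bounded approximants. -/

noncomputable section

namespace SemilinearEvolution

open Filter Topology

/-! ### Resolvents and bounded approximants of a self-adjoint operator. -/

section Stone

variable {H : Type*} [NormedAddCommGroup H] [InnerProductSpace ℂ H] [CompleteSpace H]
  {A : H →ₗ.[ℂ] H}

theorem inner_eq_of_mem_graph (hA : IsSelfAdjoint A) {x y u v : H}
    (hx : (x, y) ∈ A.graph) (hu : (u, v) ∈ A.graph) : ⟪y, u⟫_ℂ = ⟪x, v⟫_ℂ := by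
  have h := LinearPMap.adjoint_isFormalAdjoint hA.dense_domain
  rw [LinearPMap.isSelfAdjoint_def.1 hA] at h
  obtain ⟨x', rfl, rfl⟩ := (LinearPMap.mem_graph_iff A).1 hx
  obtain ⟨u', rfl, rfl⟩ := (LinearPMap.mem_graph_iff A).1 hu
  exact h x' u'

theorem mem_graph_of_inner_eq (hA : IsSelfAdjoint A) {x y : H}
    (h : ∀ u v, (u, v) ∈ A.graph → ⟪y, u⟫_ℂ = ⟪x, v⟫_ℂ) : (x, y) ∈ A.graph := by
  have h' : ∀ u : A.domain, ⟪y, (u : H)⟫_ℂ = ⟪x, A u⟫_ℂ := fun u => h _ _ (A.mem_graph u)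
  have hx : x ∈ A.adjoint.domain := LinearPMap.mem_adjoint_domain_of_exists x ⟨y, h'⟩
  have e : A.adjoint ⟨x, hx⟩ = y := LinearPMap.adjoint_apply_eq hA.dense_domain ⟨x, hx⟩ h'
  have hg : (x, y) ∈ A.adjoint.graph := e ▸ A.adjoint.mem_graph ⟨x, hx⟩
  rwa [LinearPMap.isSelfAdjoint_def.1 hA] at hg

/-- By symmetry `⟪u, v⟫` is real, so `⟪u, v + icu⟫` has imaginary part `c‖u‖²`; Cauchy-Schwarz
concludes. -/
theorem abs_mul_norm_le_of_mem_graph (hA : IsSelfAdjoint A) (c : ℝ) {u v : H}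
    (hu : (u, v) ∈ A.graph) : |c| * ‖u‖ ≤ ‖v + ((c : ℂ) * Complex.I) • u‖ := by
  have h1 : (⟪u, v⟫_ℂ).im = 0 := by
    have h := inner_eq_of_mem_graph hA hu hu
    rw [← inner_conj_symm] at h
    have := congrArg Complex.im h
    simp only [Complex.conj_im] at this
    linarith
  have h2 : (⟪u, v + ((c : ℂ) * Complex.I) • u⟫_ℂ).im = c * ‖u‖ ^ 2 := by
    rw [inner_add_right, inner_smul_right, inner_self_eq_norm_sq_to_K, Complex.add_im, h1]
    norm_cast
    simp [-Complex.ofReal_pow]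
  have h3 : |c| * ‖u‖ ^ 2 ≤ ‖u‖ * ‖v + ((c : ℂ) * Complex.I) • u‖ := by
    calc |c| * ‖u‖ ^ 2 = |(⟪u, v + ((c : ℂ) * Complex.I) • u⟫_ℂ).im| := by
          rw [h2, abs_mul, abs_of_nonneg (sq_nonneg ‖u‖)]
      _ ≤ ‖⟪u, v + ((c : ℂ) * Complex.I) • u⟫_ℂ‖ := Complex.abs_im_le_norm _
      _ ≤ _ := norm_inner_le_norm _ _
  rcases (norm_nonneg u).eq_or_lt with h | h
  · rw [← h, mul_zero]; exact norm_nonneg _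
  · have : ‖u‖ * (|c| * ‖u‖) ≤ ‖u‖ * ‖v + ((c : ℂ) * Complex.I) • u‖ := by
      rw [← mul_assoc, mul_comm ‖u‖ |c|, mul_assoc, ← sq]; exact h3
    exact le_of_mul_le_mul_left this h

/-- The map `(u, A u) ↦ A u + i c u` on the graph of `A`. -/
def shiftGraph (A : H →ₗ.[ℂ] H) (c : ℝ) : A.graph →ₗ[ℂ] H :=
  (LinearMap.snd ℂ H H + ((c : ℂ) * Complex.I) • LinearMap.fst ℂ H H) ∘ₗ A.graph.subtype

omit [CompleteSpace H] in
theorem shiftGraph_apply (c : ℝ) (p : A.graph) :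
    shiftGraph A c p = p.1.2 + ((c : ℂ) * Complex.I) • p.1.1 := rfl

theorem norm_le_shiftGraph (hA : IsSelfAdjoint A) {c : ℝ} (hc : c ≠ 0) (p : A.graph) :
    ‖p‖ ≤ (2 + |c|⁻¹) * ‖shiftGraph A c p‖ := by
  have hc' : 0 < |c| := abs_pos.2 hc
  have h := abs_mul_norm_le_of_mem_graph hA c (u := p.1.1) (v := p.1.2) p.2
  rw [← shiftGraph_apply] at h
  set R := ‖shiftGraph A c p‖ with hR
  have hR0 : 0 ≤ R := norm_nonneg _
  have h1 : ‖p.1.1‖ ≤ |c|⁻¹ * R := by rwa [le_inv_mul_iff₀ hc']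
  have h2 : ‖p.1.2‖ ≤ 2 * R := by
    have : p.1.2 = shiftGraph A c p - ((c : ℂ) * Complex.I) • p.1.1 := by
      rw [shiftGraph_apply]; abel
    rw [this]
    refine (norm_sub_le _ _).trans ?_
    rw [norm_smul, norm_mul, Complex.norm_I, mul_one, Complex.norm_real, Real.norm_eq_abs]
    linarith
  have h3 : 0 ≤ |c|⁻¹ * R := by positivity
  change max ‖p.1.1‖ ‖p.1.2‖ ≤ _
  rw [add_mul]
  exact max_le (by linarith) (by linarith)

/-- The lower bound and completeness of the graph make the range closed. A vector `y` orthogonal to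
it satisfies `A y = icy` by self-adjointness, and the lower bound for `-c` forces `y = 0`. -/
theorem shiftGraph_bijective (hA : IsSelfAdjoint A) {c : ℝ} (hc : c ≠ 0) :
    Function.Bijective (shiftGraph A c) := by
  have hanti : AntilipschitzWith (2 + |c|⁻¹).toNNReal (shiftGraph A c) := by
    refine AddMonoidHomClass.antilipschitz_of_bound _ fun p => ?_
    rw [Real.coe_toNNReal _ (by positivity)]
    exact norm_le_shiftGraph hA hc p
  refine ⟨hanti.injective, ?_⟩
  have hcont : Continuous (shiftGraph A c) := by
    have : (shiftGraph A c : A.graph → H) =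
      fun p => p.1.2 + ((c : ℂ) * Complex.I) • p.1.1 := rfl
    rw [this]; fun_prop
  have : CompleteSpace A.graph :=
    (show IsClosed (A.graph : Set (H × H)) from hA.isClosed).completeSpace_coe
  have hcl : IsClosed ((LinearMap.range (shiftGraph A c) : Submodule ℂ H) : Set H) := by
    rw [LinearMap.coe_range]
    refine hanti.isClosed_range ?_
    exact (AddMonoidHomClass.lipschitz_of_bound (shiftGraph A c) (1 + |c|) fun p => by
      rw [shiftGraph_apply]
      refine (norm_add_le _ _).trans ?_
      rw [norm_smul, norm_mul, Complex.norm_I, mul_one, Complex.norm_real, Real.norm_eq_abs,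
        add_mul, one_mul]
      have h1 : ‖p.1.1‖ ≤ ‖p‖ := norm_fst_le p.1
      have h2 : ‖p.1.2‖ ≤ ‖p‖ := norm_snd_le p.1
      gcongr).uniformContinuous
  rw [← LinearMap.range_eq_top]
  have hcl' := hcl.submodule_topologicalClosure_eq
  rw [← hcl', Submodule.topologicalClosure_eq_top_iff, Submodule.eq_bot_iff]
  intro y hy
  have hy' : (y, ((c : ℂ) * Complex.I) • y) ∈ A.graph := by
    refine mem_graph_of_inner_eq hA fun u v huv => ?_
    have h := (Submodule.mem_orthogonal' _ _).1 hy _ ⟨⟨(u, v), huv⟩, rfl⟩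
    rw [shiftGraph_apply, inner_add_right, inner_smul_right] at h
    rw [inner_smul_left, map_mul, Complex.conj_I, Complex.conj_ofReal]
    simp only at h
    linear_combination -h
  have h := abs_mul_norm_le_of_mem_graph hA (-c) hy'
  have e : ((c : ℂ) * Complex.I) • y + (((-c : ℝ) : ℂ) * Complex.I) • y = 0 := by
    rw [← add_smul]; simp
  rw [e, norm_zero, abs_neg] at h
  have hc' : 0 < |c| := abs_pos.2 hc
  exact norm_eq_zero.1 (le_antisymm (nonpos_of_mul_nonpos_right h hc') (norm_nonneg _))

theorem exists_resolvent (hA : IsSelfAdjoint A) (c : ℝ) (hc : c ≠ 0) :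
    ∃ S : H →L[ℂ] H, (∀ x, (S x, x - ((c : ℂ) * Complex.I) • S x) ∈ A.graph) ∧
      (∀ u v, (u, v) ∈ A.graph → S (v + ((c : ℂ) * Complex.I) • u) = u) ∧
      ∀ x, ‖S x‖ ≤ |c|⁻¹ * ‖x‖ := by
  let e := LinearEquiv.ofBijective (shiftGraph A c) (shiftGraph_bijective hA hc)
  let S₀ : H →ₗ[ℂ] H := LinearMap.fst ℂ H H ∘ₗ A.graph.subtype ∘ₗ e.symm.toLinearMap
  have hS₀ : ∀ x, S₀ x = (e.symm x).1.1 := fun _ => rfl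
  have key : ∀ x, (e.symm x).1.2 + ((c : ℂ) * Complex.I) • S₀ x = x := fun x => by
    rw [hS₀, ← shiftGraph_apply]; exact e.apply_symm_apply x
  have hb : ∀ x, ‖S₀ x‖ ≤ |c|⁻¹ * ‖x‖ := fun x => by
    rw [le_inv_mul_iff₀ (abs_pos.2 hc)]
    have := abs_mul_norm_le_of_mem_graph hA c (u := (e.symm x).1.1) (v := (e.symm x).1.2)
      (e.symm x).2
    rwa [← hS₀, key] at this
  refine ⟨S₀.mkContinuous _ hb, fun x => ?_, fun u v huv => ?_, hb⟩
  · have h1 : x - ((c : ℂ) * Complex.I) • S₀ x = (e.symm x).1.2 :=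
      sub_eq_of_eq_add (key x).symm
    change (S₀ x, x - ((c : ℂ) * Complex.I) • S₀ x) ∈ A.graph
    rw [h1]
    exact (e.symm x).2
  · change (e.symm (shiftGraph A c ⟨(u, v), huv⟩)).1.1 = u
    have : e.symm (shiftGraph A c ⟨(u, v), huv⟩) = ⟨(u, v), huv⟩ :=
      e.symm_apply_apply ⟨(u, v), huv⟩
    rw [this]

/-- On the dense domain `ic S u - u = -S (A u) = O(1/|c|)`, and the operators `ic S` are
contractions. -/
theorem tendsto_smul_resolvent (hA : IsSelfAdjoint A) {S : ℝ → H →L[ℂ] H}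
    (hS : ∀ c ≠ 0, ∀ u v, (u, v) ∈ A.graph → S c (v + ((c : ℂ) * Complex.I) • u) = u)
    (hb : ∀ c ≠ 0, ∀ x, ‖S c x‖ ≤ |c|⁻¹ * ‖x‖) {c : ℕ → ℝ} (hc0 : ∀ n, c n ≠ 0)
    (hc : Tendsto (fun n => |c n|) atTop atTop) (w : H) :
    Tendsto (fun n => ((c n : ℂ) * Complex.I) • S (c n) w) atTop (𝓝 w) := by
  rw [Metric.tendsto_atTop]
  intro ε hε
  obtain ⟨u, hu, hwu⟩ := Metric.mem_closure_iff.1 (hA.dense_domain w) (ε / 4) (by positivity)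
  have hlim : Tendsto (fun n => |c n|⁻¹ * ‖A ⟨u, hu⟩‖) atTop (𝓝 0) := by
    simpa using (tendsto_inv_atTop_zero.comp hc).mul_const ‖A ⟨u, hu⟩‖
  obtain ⟨n₀, hn₀⟩ := eventually_atTop.1 (hlim.eventually_lt_const (show 0 < ε / 4 by positivity))
  refine ⟨n₀, fun n hn => ?_⟩
  have h1 : ((c n : ℂ) * Complex.I) • S (c n) u - u = - S (c n) (A ⟨u, hu⟩) := by
    have := hS (c n) (hc0 n) _ _ (A.mem_graph ⟨u, hu⟩)
    rw [map_add, map_smul] at this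
    rw [eq_neg_iff_add_eq_zero, sub_add_eq_add_sub, add_comm, this, sub_self]
  have h2 : ‖((c n : ℂ) * Complex.I) • S (c n) (w - u)‖ ≤ ‖w - u‖ := by
    rw [norm_smul, norm_mul, Complex.norm_I, mul_one, Complex.norm_real, Real.norm_eq_abs]
    have := hb (c n) (hc0 n) (w - u)
    rwa [le_inv_mul_iff₀ (abs_pos.2 (hc0 n))] at this
  have h3 : ‖S (c n) (A ⟨u, hu⟩)‖ < ε / 4 := (hb _ (hc0 n) _).trans_lt (hn₀ n hn)
  rw [dist_eq_norm] at hwu ⊢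
  have h4 : ((c n : ℂ) * Complex.I) • S (c n) w - w =
      ((c n : ℂ) * Complex.I) • S (c n) (w - u) + (((c n : ℂ) * Complex.I) • S (c n) u - u)
        - (w - u) := by
    rw [map_sub, smul_sub]; abel
  rw [h4, h1]
  calc _ ≤ ‖((c n : ℂ) * Complex.I) • S (c n) (w - u) + - S (c n) (A ⟨u, hu⟩)‖ + ‖w - u‖ :=
        norm_sub_le _ _
    _ ≤ ‖((c n : ℂ) * Complex.I) • S (c n) (w - u)‖ + ‖S (c n) (A ⟨u, hu⟩)‖ + ‖w - u‖ := by
        gcongr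
        exact (norm_add_le _ _).trans_eq (by rw [norm_neg])
    _ < ε := by linarith

theorem exists_yosida (hA : IsSelfAdjoint A) :
    ∃ B : ℕ → H →L[ℂ] H, (∀ n, IsSelfAdjoint (B n)) ∧ (∀ m n, Commute (B m) (B n)) ∧
      ∀ x y, (x, y) ∈ A.graph → Tendsto (fun n => B n x) atTop (𝓝 y) := by
  choose! S hS1 hS2 hS3 using exists_resolvent hA
  have hcomm : ∀ c ≠ 0, ∀ d ≠ 0, Commute (S c) (S d) := by
    intro c hc d hd
    ext x
    change S c (S d x) = S d (S c x)
    have h : (S c (S d x), S c x - ((d : ℂ) * Complex.I) • S c (S d x)) ∈ A.graph := by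
      have h1 := hS2 c hc _ _ (hS1 d hd x)
      have h2 := hS1 c hc (S d x)
      have h3 : S c x - ((d : ℂ) * Complex.I) • S c (S d x) =
          S d x - ((c : ℂ) * Complex.I) • S c (S d x) := by
        rw [map_add, map_sub, map_smul, map_smul] at h1
        exact eq_sub_iff_add_eq.2 h1
      rw [h3]; exact h2
    have := hS2 d hd _ _ h
    rw [sub_add_cancel] at this
    exact this.symm
  have hadj : ∀ c ≠ 0, ContinuousLinearMap.adjoint (S c) = S (-c) := by
    intro c hc
    symm
    rw [ContinuousLinearMap.eq_adjoint_iff]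
    intro y x
    have h := inner_eq_of_mem_graph hA (hS1 (-c) (neg_ne_zero.2 hc) y) (hS1 c hc x)
    rw [inner_sub_left, inner_sub_right, inner_smul_left, inner_smul_right, map_mul,
      Complex.conj_I, Complex.conj_ofReal] at h
    push_cast at h
    linear_combination -h
  let c : ℕ → ℝ := fun n => n + 1
  have hc0 : ∀ n, c n ≠ 0 := fun n => by positivity
  have hc : Tendsto c atTop atTop := tendsto_atTop_add_const_right _ _ tendsto_natCast_atTop_atTop
  -- This is `c² A (A² + c²)⁻¹`. Averaging over `±c` makes it self-adjoint, since the adjoint of `S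
  -- c` is `S (-c)`.
  refine ⟨fun n => ((c n : ℂ) ^ 2 / 2) • (S (c n) + S (-c n)), fun n => ?_, fun m n => ?_,
    fun x y hxy => ?_⟩
  · rw [ContinuousLinearMap.isSelfAdjoint_iff']
    rw [map_smulₛₗ, map_add, hadj _ (hc0 n), hadj _ (neg_ne_zero.2 (hc0 n)), neg_neg, add_comm]
    simp [Complex.conj_ofNat]
  · have h := hcomm
    have n0 := fun n => neg_ne_zero.2 (hc0 n)
    refine Commute.smul_left (Commute.smul_right ?_ _) _
    exact ((h _ (hc0 m) _ (hc0 n)).add_right (h _ (hc0 m) _ (n0 n))).add_left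
      ((h _ (n0 m) _ (hc0 n)).add_right (h _ (n0 m) _ (n0 n)))
  · have h1 := tendsto_smul_resolvent hA hS2 hS3 hc0 (tendsto_abs_atTop_atTop.comp hc) y
    have h2 := tendsto_smul_resolvent hA hS2 hS3 (c := fun n => -c n)
      (fun n => neg_ne_zero.2 (hc0 n))
      (by simpa [Function.comp_def] using tendsto_abs_atTop_atTop.comp hc) y
    have h3 := (h1.add h2).const_smul (1 / 2 : ℂ)
    have e : (1 / 2 : ℂ) • (y + y) = y := by rw [← two_smul ℂ y, smul_smul]; norm_num
    rw [e] at h3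
    refine h3.congr fun n => ?_
    have e1 := hS2 _ (hc0 n) _ _ hxy
    have e2 := hS2 _ (neg_ne_zero.2 (hc0 n)) _ _ hxy
    rw [map_add, map_smul] at e1 e2
    have e1' : S (c n) y = x - ((c n : ℂ) * Complex.I) • S (c n) x := by
      rw [eq_sub_iff_add_eq, e1]
    have e2' : S (-c n) y = x - (((-c n : ℝ) : ℂ) * Complex.I) • S (-c n) x := by
      rw [eq_sub_iff_add_eq, e2]
    change _ = ((c n : ℂ) ^ 2 / 2) • (S (c n) x + S (-c n) x)
    rw [e1', e2']
    push_cast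
    have hI : Complex.I * Complex.I = -1 := Complex.I_mul_I
    match_scalars <;> first | ring1 | linear_combination (-(c n : ℂ) ^ 2 / 2) * hI

end Stone

/-! ### Unitary groups of bounded self-adjoint operators. -/

section ExpGroup

variable {H : Type*} [NormedAddCommGroup H] [InnerProductSpace ℂ H] [CompleteSpace H]

/-- The norm continuous group `t ↦ exp (- i t B)` of a bounded operator `B`. -/
def expGroup (B : H →L[ℂ] H) (t : ℝ) : H →L[ℂ] H := NormedSpace.exp (t • (-(Complex.I • B)))

theorem expGroup_zero (B : H →L[ℂ] H) : expGroup B 0 = 1 := by simp [expGroup]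

theorem expGroup_add (B : H →L[ℂ] H) (s t : ℝ) :
    expGroup B (s + t) = expGroup B s * expGroup B t := by
  rw [expGroup, add_smul]
  let +nondep : NormedAlgebra ℚ (H →L[ℂ] H) := .restrictScalars ℚ ℂ _
  exact NormedSpace.exp_add_of_commute (((Commute.refl _).smul_left s).smul_right t)

theorem norm_expGroup_apply {B : H →L[ℂ] H} (hB : IsSelfAdjoint B) (t : ℝ) (x : H) :
    ‖expGroup B t x‖ = ‖x‖ := by
  have h : t • (-(Complex.I • B)) ∈ skewAdjoint (H →L[ℂ] H) := by
    rw [skewAdjoint.mem_iff]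
    simp [hB.star_eq]
  have hu : expGroup B t ∈ unitary (H →L[ℂ] H) := by
    let +nondep : NormedAlgebra ℚ (H →L[ℂ] H) := .restrictScalars ℚ ℂ _
    rw [expGroup]
    exact NormedSpace.exp_mem_unitary_of_mem_skewAdjoint h
  exact ContinuousLinearMap.norm_map_of_mem_unitary hu x

theorem hasDerivAt_expGroup_apply (B : H →L[ℂ] H) (x : H) (t : ℝ) :
    HasDerivAt (fun t => expGroup B t x) (expGroup B t (-(Complex.I • B x))) t := by
  have h := hasDerivAt_exp_smul_const (𝕂 := ℝ) (-(Complex.I • B)) t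
  have h2 := ((ContinuousLinearMap.apply ℂ H x).restrictScalars ℝ).hasFDerivAt.comp_hasDerivAt t h
  exact h2

theorem norm_expGroup_apply_sub_le {B : H →L[ℂ] H} (hB : IsSelfAdjoint B) (t : ℝ) (x : H) :
    ‖expGroup B t x - x‖ ≤ |t| * ‖B x‖ := by
  have h := Convex.norm_image_sub_le_of_norm_hasDerivWithin_le (C := ‖B x‖)
    (f := fun t => expGroup B t x) (s := Set.univ) (x := 0) (y := t)
    (fun t _ => (hasDerivAt_expGroup_apply B x t).hasDerivWithinAt)
    (fun t _ => by rw [norm_expGroup_apply hB, norm_neg, norm_smul, Complex.norm_I, one_mul])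
    convex_univ trivial trivial
  simpa [expGroup_zero, mul_comm] using h

/-- Commutation factors `exp(-itP)` as `exp(-itQ) exp(-it(P - Q))`; the first factor is isometric,
so only the distance of the second from the identity matters. -/
theorem norm_expGroup_sub_expGroup_le {P Q : H →L[ℂ] H} (hP : IsSelfAdjoint P)
    (hQ : IsSelfAdjoint Q) (hPQ : Commute P Q) (t : ℝ) (x : H) :
    ‖expGroup P t x - expGroup Q t x‖ ≤ |t| * ‖P x - Q x‖ := by
  have h : expGroup P t = expGroup Q t * expGroup (P - Q) t := by
    have hc : Commute (t • (-(Complex.I • Q))) (t • (-(Complex.I • (P - Q)))) :=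
      ((((hPQ.symm.sub_right (Commute.refl Q)).smul_left _).smul_right _).neg_left.neg_right.smul_left
        _).smul_right _
    let +nondep : NormedAlgebra ℚ (H →L[ℂ] H) := .restrictScalars ℚ ℂ _
    rw [expGroup, expGroup, expGroup, ← NormedSpace.exp_add_of_commute hc]
    congr 1
    module
  have e : expGroup P t x - expGroup Q t x = expGroup Q t (expGroup (P - Q) t x - x) := by
    rw [h, map_sub]; rfl
  rw [e, norm_expGroup_apply hQ]
  exact norm_expGroup_apply_sub_le (hP.sub hQ) t x

end ExpGroup

/-! ### Convergence of the approximating groups and Stone's theorem. -/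

section Stone

variable {H : Type*} [NormedAddCommGroup H] [InnerProductSpace ℂ H] [CompleteSpace H]
  {A : H →ₗ.[ℂ] H}

omit [CompleteSpace H] in
theorem ev_eq_of_mem_graph {T : H →ₗ.[ℂ] H} {x y : H} (h : (x, y) ∈ T.graph) : ev T x = y := by
  obtain ⟨x', rfl, rfl⟩ := (LinearPMap.mem_graph_iff T).1 h
  simp [ev]

omit [CompleteSpace H] in
theorem mem_graph_ev {T : H →ₗ.[ℂ] H} {x : H} (h : x ∈ T.domain) : (x, ev T x) ∈ T.graph := by
  have := T.mem_graph ⟨x, h⟩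
  rwa [← ev_eq_of_mem_graph this] at this

/-- For `u` in the domain the difference is at most `|t| ‖B m u - B n u‖`; isometry and density
extend this to all `x`. -/
theorem uniformCauchySeqOn_expGroup (hA : IsSelfAdjoint A) {B : ℕ → H →L[ℂ] H}
    (hsa : ∀ n, IsSelfAdjoint (B n)) (hcomm : ∀ m n, Commute (B m) (B n))
    (hlim : ∀ x y, (x, y) ∈ A.graph → Tendsto (fun n => B n x) atTop (𝓝 y)) (x : H) (T : ℝ) :
    UniformCauchySeqOn (fun n t => expGroup (B n) t x) atTop (Metric.ball 0 T) := by
  rw [Metric.uniformCauchySeqOn_iff]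
  intro ε hε
  obtain ⟨u, hu, hxu⟩ := Metric.mem_closure_iff.1 (hA.dense_domain x) (ε / 4) (by positivity)
  rw [dist_eq_norm] at hxu
  have hC := (hlim _ _ (A.mem_graph ⟨u, hu⟩)).cauchySeq
  obtain ⟨n₀, hn₀⟩ := Metric.cauchySeq_iff.1 hC (ε / (4 * (|T| + 1))) (by positivity)
  refine ⟨n₀, fun m hm n hn t ht => ?_⟩
  have ht' : |t| ≤ |T| + 1 := by
    rw [mem_ball_zero_iff, Real.norm_eq_abs] at ht
    linarith [le_abs_self T]
  have h1 : ‖expGroup (B m) t u - expGroup (B n) t u‖ ≤ ε / 4 := by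
    refine (norm_expGroup_sub_expGroup_le (hsa m) (hsa n) (hcomm m n) t u).trans ?_
    have := hn₀ m hm n hn
    rw [dist_eq_norm] at this
    calc |t| * ‖B m u - B n u‖ ≤ (|T| + 1) * (ε / (4 * (|T| + 1))) := by gcongr
      _ = ε / 4 := by field_simp
  have e : expGroup (B m) t x - expGroup (B n) t x = expGroup (B m) t (x - u) -
      expGroup (B n) t (x - u) + (expGroup (B m) t u - expGroup (B n) t u) := by
    rw [map_sub, map_sub]; abel
  rw [dist_eq_norm, e]
  calc _ ≤ ‖expGroup (B m) t (x - u)‖ + ‖expGroup (B n) t (x - u)‖ +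
        ‖expGroup (B m) t u - expGroup (B n) t u‖ :=
        (norm_add_le _ _).trans (by gcongr; exact norm_sub_le _ _)
    _ < ε := by
        rw [norm_expGroup_apply (hsa m), norm_expGroup_apply (hsa n)]; linarith

/-- **Stone's theorem**: a self-adjoint operator generates a strongly continuous group of
isometries. -/
theorem exists_isPropagator (hA : IsSelfAdjoint A) : ∃ U : ℝ → H →L[ℂ] H, IsPropagator A U := by
  obtain ⟨B, hsa, hcomm, hlim⟩ := exists_yosida hA
  have hcs := uniformCauchySeqOn_expGroup hA hsa hcomm hlim
  have hmem : ∀ t : ℝ, t ∈ Metric.ball (0 : ℝ) (|t| + 1) := fun t => by simp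
  choose V hV using fun (t : ℝ) (x : H) =>
    cauchySeq_tendsto_of_complete ((hcs x (|t| + 1)).cauchy_map (hmem t))
  have hVu : ∀ x T, TendstoUniformlyOn (fun n t => expGroup (B n) t x) (fun t => V t x) atTop
      (Metric.ball 0 T) := fun x T =>
    (hcs x T).tendstoUniformlyOn_of_tendsto fun t _ => hV t x
  have hVn : ∀ t x, ‖V t x‖ = ‖x‖ := fun t x =>
    tendsto_nhds_unique (hV t x).norm (by simp [norm_expGroup_apply (hsa _)])
  let V' : ℝ → H →ₗ[ℂ] H := fun t =>
    { toFun := V t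
      map_add' := fun x y => tendsto_nhds_unique (hV t (x + y))
        (((hV t x).add (hV t y)).congr fun n => (map_add _ _ _).symm)
      map_smul' := fun a x => tendsto_nhds_unique (hV t (a • x))
        (((hV t x).const_smul a).congr fun n => (map_smul _ _ _).symm) }
  let U : ℝ → H →L[ℂ] H := fun t =>
    (V' t).mkContinuous 1 fun x => by rw [one_mul]; exact (hVn t x).le
  have hcont : ∀ x, Continuous fun t => U t x := fun x => by
    refine continuous_iff_continuousAt.2 fun t => ?_
    have h := (hVu x (|t| + 1)).continuousOn (Frequently.of_forall fun n =>
      (continuous_iff_continuousAt.2 fun t =>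
        (hasDerivAt_expGroup_apply (B n) x t).continuousAt).continuousOn)
    exact h.continuousAt (Metric.isOpen_ball.mem_nhds (hmem t))
  have hadd : ∀ s t, U (s + t) = (U s).comp (U t) := fun s t => by
    ext x
    refine tendsto_nhds_unique (hV (s + t) x) ?_
    have h1 : Tendsto (fun n => expGroup (B n) s (V t x)) atTop (𝓝 (V s (V t x))) := hV s _
    have h2 : Tendsto (fun n => expGroup (B n) s (expGroup (B n) t x - V t x)) atTop (𝓝 0) := by
      rw [tendsto_zero_iff_norm_tendsto_zero]
      simp_rw [norm_expGroup_apply (hsa _)]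
      exact tendsto_iff_norm_sub_tendsto_zero.1 (hV t x)
    have h3 := h1.add h2
    rw [add_zero] at h3
    refine h3.congr fun n => ?_
    rw [map_sub, expGroup_add]
    change _ = expGroup (B n) s (expGroup (B n) t x)
    abel
  have hzero : U 0 = ContinuousLinearMap.id ℂ H := by
    ext x
    exact tendsto_nhds_unique (hV 0 x) (by simp [expGroup_zero])
  -- The derivatives of the approximating orbits converge uniformly near `0`: by isometry, replacing
  -- `B n x` by `y` costs exactly `‖B n x - y‖`.
  have hderiv : ∀ x y, (x, y) ∈ A.graph → HasDerivAt (fun t => U t x) (-(Complex.I • y)) 0 := by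
    intro x y hxy
    have h := hasDerivAt_of_tendstoUniformlyOn (𝕜 := ℝ) (s := Metric.ball (0 : ℝ) 1) (x := 0)
      (f := fun n t => expGroup (B n) t x) (g := fun t => V t x)
      (f' := fun n t => expGroup (B n) t (-(Complex.I • B n x)))
      (g' := fun t => V t (-(Complex.I • y))) (l := atTop) Metric.isOpen_ball ?_
      (.of_forall fun n t _ => hasDerivAt_expGroup_apply (B n) x t) (fun t _ => hV t x) (by simp)
    · change HasDerivAt _ (U 0 _) _ at h
      rw [hzero] at h
      exact h
    · rw [Metric.tendstoUniformlyOn_iff]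
      intro ε hε
      have h1 := Metric.tendstoUniformlyOn_iff.1 (hVu (-(Complex.I • y)) 1) (ε / 2) (by positivity)
      have h2 := Metric.tendsto_nhds.1 (hlim x y hxy) (ε / 2) (by positivity)
      filter_upwards [h1, h2] with n hn1 hn2 t ht
      have h3 : dist (expGroup (B n) t (-(Complex.I • y))) (expGroup (B n) t (-(Complex.I • B n x)))
          = dist (B n x) y := by
        rw [dist_eq_norm, ← map_sub, norm_expGroup_apply (hsa n), dist_eq_norm, ← neg_sub,
          norm_neg, neg_sub_neg, ← neg_sub, norm_neg, ← smul_sub, norm_smul, Complex.norm_I,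
          one_mul, ← norm_neg, neg_sub]
      calc _ ≤ _ := dist_triangle _ (expGroup (B n) t (-(Complex.I • y))) _
        _ < ε := by rw [h3]; linarith [hn1 t ht]
  refine ⟨U, hzero, hadd, hVn, hcont, fun x => ⟨fun hx => ?_, fun hx => ?_⟩, fun x hx => ?_⟩
  · exact (hderiv x _ (mem_graph_ev hx)).differentiableAt
  -- Differentiating `⟪U t x, u⟫ = ⟪x, U (-t) u⟫` at `0` puts `(x, iy)` in the graph of the adjoint,
  -- which is that of `A`.
  · have hd := hx.hasDerivAt
    set y := deriv (fun t => U t x) 0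
    refine LinearPMap.mem_domain_of_mem_graph (y := Complex.I • y) (mem_graph_of_inner_eq hA ?_)
    intro u v huv
    have h1 : HasDerivAt (fun t => ⟪U t x, u⟫_ℂ) ⟪y, u⟫_ℂ 0 := by
      simpa using hd.inner ℂ (hasDerivAt_const 0 u)
    have h2 : HasDerivAt (fun t => ⟪U t x, u⟫_ℂ) ⟪x, Complex.I • v⟫_ℂ 0 := by
      have hneg : HasDerivAt (fun t => U (-t) u) (Complex.I • v) 0 := by
        have := HasDerivAt.scomp (0 : ℝ) (h := fun t : ℝ => -t) (g₁ := fun t => U t u)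
          (g₁' := -(Complex.I • v)) (h' := -1) (by simpa using hderiv u v huv) (hasDerivAt_neg 0)
        simpa [Function.comp_def] using this
      have h3 : HasDerivAt (fun t => ⟪x, U (-t) u⟫_ℂ) ⟪x, Complex.I • v⟫_ℂ 0 := by
        have := (hasDerivAt_const (0 : ℝ) x).inner ℂ hneg
        rwa [neg_zero, hzero, inner_zero_left, add_zero] at this
      refine h3.congr_of_eventuallyEq (.of_forall fun t => ?_)
      have e : U t (U (-t) u) = u := by
        have := hadd t (-t)
        rw [add_neg_cancel, hzero] at this
        exact (congrArg (fun S : H →L[ℂ] H => S u) this).symm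
      let Ui : H →ₗᵢ[ℂ] H := ⟨(U t : H →ₗ[ℂ] H), hVn t⟩
      change ⟪U t x, u⟫_ℂ = ⟪x, U (-t) u⟫_ℂ
      conv_lhs => rw [← e]
      exact Ui.inner_map_map _ _
    have h4 := h1.unique h2
    rw [inner_smul_left, h4, inner_smul_right, Complex.conj_I, ← mul_assoc]
    simp
  · exact hderiv x _ (mem_graph_ev hx)

end Stone

/-! ### Uniqueness and continuation for ordinary differential equations in a Banach space. -/

section ODE

variable {X : Type*} [NormedAddCommGroup X] [NormedSpace ℝ X] {f : ℝ → X → X}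

theorem _root_.HasDerivWithinAt.of_Ico {v : ℝ → X} {y : X} {a T t : ℝ} {s : Set ℝ}
    (h : HasDerivWithinAt v y (Set.Ico a T) t) (ht : t < T) (hs : s ⊆ Set.Ici a) :
    HasDerivWithinAt v y s t := by
  refine h.mono_of_mem_nhdsWithin ?_
  filter_upwards [self_mem_nhdsWithin, mem_nhdsWithin_of_mem_nhds (Iio_mem_nhds ht)] with r hr hrT
  exact ⟨hs hr, hrT⟩

/-- Uniqueness for a vector field that is Lipschitz on bounded subsets of `D`, uniformly in
time, for integral curves that stay in `D`. -/
theorem eqOn_of_isIntegralCurveOn_Ico {D : Set X}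
    (hlip : ∀ R, ∃ K, ∀ t, LipschitzOnWith K (f t) (D ∩ Metric.closedBall 0 R)) {v w : ℝ → X}
    {T : ℝ} (hv : IsIntegralCurveOn v f (Set.Ico 0 T)) (hvD : ∀ t ∈ Set.Ico 0 T, v t ∈ D)
    (hw : IsIntegralCurveOn w f (Set.Ico 0 T)) (hwD : ∀ t ∈ Set.Ico 0 T, w t ∈ D)
    (h0 : v 0 = w 0) : Set.EqOn v w (Set.Ico 0 T) := by
  intro t ht
  have hsub : Set.Icc 0 t ⊆ Set.Ico 0 T := fun s hs => ⟨hs.1, hs.2.trans_lt ht.2⟩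
  have hvc : ContinuousOn v (Set.Icc 0 t) := fun s hs =>
    (hv s (hsub hs)).continuousWithinAt.mono hsub
  have hwc : ContinuousOn w (Set.Icc 0 t) := fun s hs =>
    (hw s (hsub hs)).continuousWithinAt.mono hsub
  obtain ⟨M₁, hM₁⟩ := isCompact_Icc.exists_bound_of_continuousOn hvc
  obtain ⟨M₂, hM₂⟩ := isCompact_Icc.exists_bound_of_continuousOn hwc
  obtain ⟨K, hK⟩ := hlip (max M₁ M₂)
  refine ODE_solution_unique_of_mem_Icc_right (v := f) (K := K)
    (s := fun _ => D ∩ Metric.closedBall 0 (max M₁ M₂)) (fun s _ => hK s) hvc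
    (fun s hs => ?_) (fun s hs => ?_) hwc (fun s hs => ?_) (fun s hs => ?_) h0
    ⟨ht.1, le_rfl⟩
  · exact (hv s (hsub ⟨hs.1, hs.2.le⟩)).of_Ico (hs.2.trans ht.2) (Set.Ici_subset_Ici.2 hs.1)
  · refine ⟨hvD s (hsub ⟨hs.1, hs.2.le⟩), ?_⟩
    rw [mem_closedBall_zero_iff]
    exact (hM₁ s ⟨hs.1, hs.2.le⟩).trans (le_max_left _ _)
  · exact (hw s (hsub ⟨hs.1, hs.2.le⟩)).of_Ico (hs.2.trans ht.2) (Set.Ici_subset_Ici.2 hs.1)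
  · refine ⟨hwD s (hsub ⟨hs.1, hs.2.le⟩), ?_⟩
    rw [mem_closedBall_zero_iff]
    exact (hM₂ s ⟨hs.1, hs.2.le⟩).trans (le_max_right _ _)

theorem exists_forall_isIntegralCurveOn_Ico
    (hlip : ∀ R, ∃ K, ∀ t, LipschitzOnWith K (f t) (Metric.closedBall 0 R)) {x₀ : X} {S : Set ℝ}
    (hS : ∀ T ∈ S, ∃ v, v 0 = x₀ ∧ IsIntegralCurveOn v f (Set.Ico 0 T)) :
    ∃ w, w 0 = x₀ ∧ ∀ T ∈ S, IsIntegralCurveOn w f (Set.Ico 0 T) := by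
  classical
  choose! v hv0 hv using hS
  -- By uniqueness the value does not depend on which interval beyond `t` is chosen.
  let w : ℝ → X := fun t => if h : ∃ T ∈ S, t < T then v h.choose t else x₀
  have hw : ∀ T ∈ S, Set.EqOn w (v T) (Set.Ico 0 T) := by
    intro T hT t ht
    have h : ∃ T ∈ S, t < T := ⟨T, hT, ht.2⟩
    have e : w t = v h.choose t := dif_pos h
    rw [e]
    obtain ⟨hT', ht'⟩ := h.choose_spec
    set T' := h.choose
    have hsub1 : Set.Ico 0 (min T T') ⊆ Set.Ico 0 T := Set.Ico_subset_Ico_right (min_le_left _ _)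
    have hsub2 : Set.Ico 0 (min T T') ⊆ Set.Ico 0 T' := Set.Ico_subset_Ico_right (min_le_right _ _)
    exact eqOn_of_isIntegralCurveOn_Ico (D := Set.univ) (by simpa using hlip)
      ((hv T' hT').mono hsub2) (by simp) ((hv T hT).mono hsub1) (by simp)
      ((hv0 T' hT').trans (hv0 T hT).symm) ⟨ht.1, lt_min ht.2 ht'⟩
  refine ⟨w, ?_, fun T hT t ht => ?_⟩
  · by_cases h : ∃ T ∈ S, (0 : ℝ) < T
    · have e : w 0 = v h.choose 0 := dif_pos h
      rw [e]; exact hv0 _ h.choose_spec.1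
    · exact dif_neg h
  · rw [hw T hT ht]
    exact (hv T hT t ht).congr (hw T hT) (hw T hT ht)

variable [CompleteSpace X]

theorem exists_uniform_local_isIntegralCurveOn (hcont : ∀ x, Continuous (f · x))
    (hlip : ∀ R, ∃ K, ∀ t, LipschitzOnWith K (f t) (Metric.closedBall 0 R)) (T M : ℝ)
    (hM : 0 ≤ M) :
    ∃ δ > 0, ∀ t₀ ∈ Set.Icc 0 T, ∀ x, ‖x‖ ≤ M →
      ∃ α : ℝ → X, α t₀ = x ∧ IsIntegralCurveOn α f (Set.Icc t₀ (t₀ + δ)) := by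
  obtain ⟨K, hK⟩ := hlip (M + 1)
  obtain ⟨C, hC⟩ := isCompact_Icc.exists_bound_of_continuousOn
    (hcont 0).continuousOn (s := Set.Icc (0 : ℝ) (T + 1))
  let L : NNReal := ⟨|C| + K * (M + 1), by positivity⟩
  have hL : (L : ℝ) = |C| + K * (M + 1) := rfl
  have hL0 : 0 ≤ (L : ℝ) := L.2
  -- The bound `δ ≤ 1` keeps times inside `[0, T + 1]`, where `C` controls `f t 0`; `δ ≤ 1 / (L +
  -- 1)` keeps the curve in the unit ball around `x`.
  let δ : ℝ := min 1 (1 / (L + 1))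
  have hδ : 0 < δ := by positivity
  refine ⟨δ, hδ, fun t₀ ht₀ x hx => ?_⟩
  have hball : Metric.closedBall x 1 ⊆ Metric.closedBall 0 (M + 1) :=
    Metric.closedBall_subset_closedBall' (by rw [dist_zero_right]; linarith)
  have hp : IsPicardLindelof f (tmin := t₀) (tmax := t₀ + δ) ⟨t₀, le_rfl, by linarith⟩ x 1 0 L K :=
    { lipschitzOnWith := fun t _ => (hK t).mono (by simpa using hball)
      continuousOn := fun y _ => (hcont y).continuousOn
      norm_le := fun t ht y hy => by
        have hy' : y ∈ Metric.closedBall 0 (M + 1) := hball (by simpa using hy)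
        have h0 : (0 : X) ∈ Metric.closedBall 0 (M + 1) := by simp; linarith
        have h1 := (hK t).dist_le_mul y hy' 0 h0
        rw [dist_eq_norm, dist_zero_right] at h1
        have h2 := hC t ⟨ht₀.1.trans ht.1, ht.2.trans (add_le_add ht₀.2 (min_le_left _ _))⟩
        rw [mem_closedBall_zero_iff] at hy'
        calc ‖f t y‖ = ‖(f t y - f t 0) + f t 0‖ := by rw [sub_add_cancel]
          _ ≤ K * ‖y‖ + C := (norm_add_le _ _).trans (add_le_add h1 h2)
          _ ≤ K * (M + 1) + |C| := by gcongr; exact le_abs_self C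
          _ = L := by rw [hL, add_comm]
      mul_max_le := by
        have h1 : max (t₀ + δ - t₀) (t₀ - t₀) = δ := by
          rw [add_sub_cancel_left, sub_self, max_eq_left hδ.le]
        change (L : ℝ) * max (t₀ + δ - t₀) (t₀ - t₀) ≤ _
        rw [h1]
        have h2 : (L : ℝ) * δ ≤ L * (1 / (L + 1)) := by gcongr; exact min_le_right _ _
        have h3 : (L : ℝ) * (1 / (L + 1)) ≤ 1 := by
          rw [mul_one_div, div_le_one (by positivity)]; linarith
        simpa using h2.trans h3 }
  exact hp.exists_eq_forall_mem_Icc_hasDerivWithinAt₀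

omit [CompleteSpace X] in
theorem exists_isIntegralCurveOn_glue {v α : ℝ → X} {T t₀ δ : ℝ} (ht₀ : t₀ ∈ Set.Ico 0 T)
    (hv : IsIntegralCurveOn v f (Set.Ico 0 T)) (hα0 : α t₀ = v t₀)
    (hα : IsIntegralCurveOn α f (Set.Icc t₀ (t₀ + δ))) :
    ∃ w, w 0 = v 0 ∧ IsIntegralCurveOn w f (Set.Ico 0 (t₀ + δ)) := by
  classical
  let w : ℝ → X := fun t => if t ≤ t₀ then v t else α t
  have hwv : ∀ t ≤ t₀, w t = v t := fun t h => if_pos h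
  have hwα : ∀ t ≥ t₀, w t = α t := fun t h => by
    rcases h.eq_or_lt with rfl | h
    · rw [hwv _ le_rfl, hα0]
    · exact if_neg (not_le.2 h)
  refine ⟨w, hwv 0 ht₀.1, fun t ht => ?_⟩
  have hleft : t ≤ t₀ → HasDerivWithinAt w (f t (w t)) (Set.Icc 0 t₀) t := fun h => by
    rw [hwv t h]
    exact ((hv t ⟨ht.1, h.trans_lt ht₀.2⟩).mono fun s hs => ⟨hs.1, hs.2.trans_lt ht₀.2⟩).congr
      (fun s hs => hwv s hs.2) (hwv t h)
  have hright : t₀ ≤ t → HasDerivWithinAt w (f t (w t)) (Set.Icc t₀ (t₀ + δ)) t := fun h => by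
    rw [hwα t h]
    exact (hα t ⟨h, ht.2.le⟩).congr (fun s hs => hwα s hs.1) (hwα t h)
  rcases lt_trichotomy t t₀ with h | rfl | h
  · refine (hleft h.le).mono_of_mem_nhdsWithin ?_
    filter_upwards [self_mem_nhdsWithin, mem_nhdsWithin_of_mem_nhds (Iio_mem_nhds h)]
      with r hr hrT
    exact ⟨hr.1, le_of_lt hrT⟩
  · refine ((hleft le_rfl).union (hright le_rfl)).mono fun s hs => ?_
    rcases le_total s t with h | h
    · exact .inl ⟨hs.1, h⟩
    · exact .inr ⟨h, hs.2.le⟩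
  · refine (hright h.le).mono_of_mem_nhdsWithin ?_
    filter_upwards [self_mem_nhdsWithin, mem_nhdsWithin_of_mem_nhds (Ioi_mem_nhds h)]
      with r hr hrT
    exact ⟨le_of_lt hrT, hr.2.le⟩

/-- Global existence for a vector field that is continuous in time and Lipschitz on bounded sets,
uniformly in time, from an a priori bound for the solutions on bounded time intervals. -/
theorem exists_isIntegralCurveOn_Ici_of_bounded (hcont : ∀ x, Continuous (f · x))
    (hlip : ∀ R, ∃ K, ∀ t, LipschitzOnWith K (f t) (Metric.closedBall 0 R)) (x₀ : X)
    (hbdd : ∀ T > 0, ∀ v : ℝ → X, v 0 = x₀ → IsIntegralCurveOn v f (Set.Ico 0 T) →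
      ∃ M, ∀ t ∈ Set.Ico 0 T, ‖v t‖ ≤ M) :
    ∃ v : ℝ → X, v 0 = x₀ ∧ IsIntegralCurveOn v f (Set.Ici 0) := by
  let S : Set ℝ := {T | ∃ v : ℝ → X, v 0 = x₀ ∧ IsIntegralCurveOn v f (Set.Ico 0 T)}
  obtain ⟨w, hw0, hw⟩ := exists_forall_isIntegralCurveOn_Ico hlip (x₀ := x₀) (S := S)
    fun T hT => hT
  have hext : ∀ T, (∀ t < T, ∃ T' ∈ S, t < T') → IsIntegralCurveOn w f (Set.Ico 0 T) := by
    intro T hT t ht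
    obtain ⟨T', hT', htT'⟩ := hT t ht.2
    exact (hw T' hT' t ⟨ht.1, htT'⟩).of_Ico htT' Set.Ico_subset_Ici_self
  suffices hall : ∀ T, ∃ T' ∈ S, T < T' by
    refine ⟨w, hw0, fun t ht => ?_⟩
    obtain ⟨T', hT', htT'⟩ := hall t
    exact (hw T' hT' t ⟨ht, htT'⟩).of_Ico htT' le_rfl
  -- Every `T ≤ 0` lies in `S` vacuously, so positivity of the supremum needs a genuine local
  -- solution.
  have hpos : ∃ T ∈ S, 0 < T := by
    obtain ⟨δ, hδ, h⟩ := exists_uniform_local_isIntegralCurveOn hcont hlip 0 ‖x₀‖ (norm_nonneg _)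
    obtain ⟨α, hα0, hα⟩ := h 0 (by simp) x₀ le_rfl
    exact ⟨δ, ⟨α, hα0, hα.mono (by rw [zero_add]; exact Set.Ico_subset_Icc_self)⟩, hδ⟩
  obtain ⟨T₀, hT₀, hT₀pos⟩ := hpos
  by_contra! hcon
  obtain ⟨B, hB⟩ := hcon
  have hbdd' : BddAbove S := ⟨B, hB⟩
  have hT : 0 < sSup S := hT₀pos.trans_le (le_csSup hbdd' hT₀)
  set T := sSup S
  have hwT := hext T fun t ht => exists_lt_of_lt_csSup ⟨T₀, hT₀⟩ ht
  obtain ⟨M, hM⟩ := hbdd T hT w hw0 hwT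
  obtain ⟨δ, hδ, h⟩ := exists_uniform_local_isIntegralCurveOn hcont hlip T |M| (abs_nonneg _)
  -- Restarting within `δ / 2` of `T` reaches at least `T + δ / 2`, past the supremum.
  have ht₀ : max 0 (T - δ / 2) ∈ Set.Ico 0 T := ⟨le_max_left _ _, max_lt hT (by linarith)⟩
  obtain ⟨α, hα0, hα⟩ := h _ ⟨ht₀.1, ht₀.2.le⟩ (w (max 0 (T - δ / 2)))
    ((hM _ ht₀).trans (le_abs_self M))
  obtain ⟨u, hu0, hu⟩ := exists_isIntegralCurveOn_glue ht₀ hwT hα0 hα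
  have hle := le_csSup hbdd' (show max 0 (T - δ / 2) + δ ∈ S from ⟨u, hu0.trans hw0, hu⟩)
  have := le_max_right 0 (T - δ / 2)
  change _ ≤ T at hle
  linarith

end ODE

/-! ### Powers of an operator and the graph-norm space. -/

section Powers

variable {H : Type*} [NormedAddCommGroup H] [InnerProductSpace ℂ H] {A : H →ₗ.[ℂ] H}

theorem mem_graph_iff_ev {T : H →ₗ.[ℂ] H} {x y : H} :
    (x, y) ∈ T.graph ↔ x ∈ T.domain ∧ ev T x = y :=
  ⟨fun h => ⟨LinearPMap.mem_domain_of_mem_graph h, ev_eq_of_mem_graph h⟩,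
    fun ⟨h, e⟩ => e ▸ mem_graph_ev h⟩

theorem ev_sub {T : H →ₗ.[ℂ] H} {x y : H} (hx : x ∈ T.domain) (hy : y ∈ T.domain) :
    ev T (x - y) = ev T x - ev T y :=
  ev_eq_of_mem_graph (T.graph.sub_mem (mem_graph_ev hx) (mem_graph_ev hy))

theorem ev_add {T : H →ₗ.[ℂ] H} {x y : H} (hx : x ∈ T.domain) (hy : y ∈ T.domain) :
    ev T (x + y) = ev T x + ev T y :=
  ev_eq_of_mem_graph (T.graph.add_mem (mem_graph_ev hx) (mem_graph_ev hy))

theorem mem_domain_compOp {S T : H →ₗ.[ℂ] H} {x : H} :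
    x ∈ (compOp S T).domain ↔ x ∈ T.domain ∧ ev T x ∈ S.domain := by
  change x ∈ ((S.domain.comap T.toFun).map T.domain.subtype) ⊓ T.domain ↔ _
  constructor
  · rintro ⟨h, hx⟩
    obtain ⟨y, hy, rfl⟩ := Submodule.mem_map.1 h
    refine ⟨hx, ?_⟩
    have : ev T (T.domain.subtype y) = T y := by simp [ev]
    rw [this]
    exact hy
  · rintro ⟨hx, h⟩
    refine ⟨Submodule.mem_map.2 ⟨⟨x, hx⟩, ?_, rfl⟩, hx⟩
    have : ev T x = T ⟨x, hx⟩ := by simp [ev, hx]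
    rw [this] at h
    exact h

theorem ev_compOp {S T : H →ₗ.[ℂ] H} {x : H} (hx : x ∈ (compOp S T).domain) :
    ev (compOp S T) x = ev S (ev T x) := by
  obtain ⟨h1, h2⟩ := mem_domain_compOp.1 hx
  have e1 : ev (compOp S T) x = compOp S T ⟨x, hx⟩ := by simp [ev, hx]
  have e2 : ev S (ev T x) = S ⟨ev T x, h2⟩ := dif_pos h2
  have e3 : ev T x = T ⟨x, h1⟩ := by simp [ev, h1]
  rw [e1, e2]
  change S ⟨T ⟨x, _⟩, _⟩ = _
  congr 2
  exact e3.symm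

theorem ev_powOp_zero (x : H) : ev (powOp A 0) x = x := by
  have h : x ∈ (powOp A 0).domain := trivial
  rw [ev, dif_pos h]
  rfl

theorem mem_domain_powOp_succ {j : ℕ} {x : H} :
    x ∈ (powOp A (j + 1)).domain ↔ x ∈ (powOp A j).domain ∧ ev (powOp A j) x ∈ A.domain :=
  mem_domain_compOp

theorem ev_powOp_succ {j : ℕ} {x : H} (hx : x ∈ (powOp A (j + 1)).domain) :
    ev (powOp A (j + 1)) x = ev A (ev (powOp A j) x) :=
  ev_compOp hx

theorem domain_powOp_antitone : Antitone fun j => (powOp A j).domain :=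
  antitone_nat_of_succ_le fun _ _ hx => (mem_domain_powOp_succ.1 hx).1

theorem mem_domain_of_mem_domain_powOp {N : ℕ} (hN : 1 ≤ N) {x : H}
    (hx : x ∈ (powOp A N).domain) : x ∈ A.domain := by
  have h := (mem_domain_powOp_succ.1 (domain_powOp_antitone hN hx)).2
  rwa [ev_powOp_zero] at h

/-- The sequences `(x, A x, …, A ^ N x)`, `x ∈ D(A ^ N)`; with the supremum norm this is `D(A ^ N)`
with its graph norm. -/
def graphSpace (A : H →ₗ.[ℂ] H) (N : ℕ) : Submodule ℂ (Fin (N + 1) → H) :=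
  ⨅ j : Fin N, A.graph.comap
    ((LinearMap.proj j.castSucc).prod (LinearMap.proj j.succ) : (Fin (N + 1) → H) →ₗ[ℂ] H × H)

theorem mem_graphSpace {N : ℕ} {u : Fin (N + 1) → H} :
    u ∈ graphSpace A N ↔ ∀ j : Fin N, (u j.castSucc, u j.succ) ∈ A.graph := by
  simp only [graphSpace, Submodule.mem_iInf, Submodule.mem_comap]
  rfl

theorem mem_graph_powOp_of_mem_graphSpace {N : ℕ} {u : Fin (N + 1) → H}
    (hu : u ∈ graphSpace A N) (j : Fin (N + 1)) : (u 0, u j) ∈ (powOp A j).graph := by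
  induction j using Fin.induction with
  | zero => exact mem_graph_iff_ev.2 ⟨trivial, ev_powOp_zero _⟩
  | succ j ih =>
    obtain ⟨h1, h2⟩ := mem_graph_iff_ev.1 ih
    obtain ⟨h3, h4⟩ := mem_graph_iff_ev.1 (mem_graphSpace.1 hu j)
    rw [Fin.val_castSucc] at h1 h2
    have h5 : u 0 ∈ (powOp A (j + 1)).domain := mem_domain_powOp_succ.2 ⟨h1, h2 ▸ h3⟩
    refine mem_graph_iff_ev.2 ⟨h5, ?_⟩
    rw [Fin.val_succ, ev_powOp_succ h5, h2, h4]

theorem mem_domain_of_mem_graphSpace {N : ℕ} {u : Fin (N + 1) → H} (hu : u ∈ graphSpace A N) :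
    u 0 ∈ (powOp A N).domain :=
  (mem_graph_iff_ev.1 (mem_graph_powOp_of_mem_graphSpace hu (Fin.last N))).1

theorem ev_powOp_of_mem_graphSpace {N : ℕ} {u : Fin (N + 1) → H} (hu : u ∈ graphSpace A N)
    (j : Fin (N + 1)) : ev (powOp A j) (u 0) = u j :=
  (mem_graph_iff_ev.1 (mem_graph_powOp_of_mem_graphSpace hu j)).2

theorem ev_powOp_mem_graphSpace {N : ℕ} {x : H} (hx : x ∈ (powOp A N).domain) :
    (fun j : Fin (N + 1) => ev (powOp A j) x) ∈ graphSpace A N := by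
  refine mem_graphSpace.2 fun j => ?_
  have h : x ∈ (powOp A (j + 1)).domain := domain_powOp_antitone j.2 hx
  refine mem_graph_iff_ev.2 ⟨(mem_domain_powOp_succ.1 h).2, ?_⟩
  rw [Fin.val_succ, ev_powOp_succ h, Fin.val_castSucc]

theorem isClosed_graphSpace (hA : A.IsClosed) (N : ℕ) :
    IsClosed (graphSpace A N : Set (Fin (N + 1) → H)) := by
  have : (graphSpace A N : Set (Fin (N + 1) → H)) =
      ⋂ j : Fin N, (fun u => (u j.castSucc, u j.succ)) ⁻¹' (A.graph : Set (H × H)) := by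
    ext u
    simp [mem_graphSpace]
  rw [this]
  exact isClosed_iInter fun j => IsClosed.preimage (by fun_prop) hA

end Powers

/-! ### The group on the domains of the powers. -/

section Propagator

variable {H : Type*} [NormedAddCommGroup H] [InnerProductSpace ℂ H] {A : H →ₗ.[ℂ] H}
  {U : ℝ → H →L[ℂ] H}

namespace IsPropagator

theorem apply_neg_apply (hU : IsPropagator A U) (t : ℝ) (x : H) : U t (U (-t) x) = x := by
  have := hU.add t (-t)
  rw [add_neg_cancel, hU.zero] at this
  exact (congrArg (fun S : H →L[ℂ] H => S x) this).symm

/-- Strong continuity handles a fixed vector; isometry absorbs the variation of `h`. -/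
theorem continuousOn_apply (hU : IsPropagator A U) {g : ℝ → ℝ} {h : ℝ → H} {s : Set ℝ}
    (hg : ContinuousOn g s) (hh : ContinuousOn h s) : ContinuousOn (fun t => U (g t) (h t)) s := by
  intro t ht
  have h1 : Tendsto (fun r => U (g r) (h t)) (𝓝[s] t) (𝓝 (U (g t) (h t))) :=
    ((hU.continuous (h t)).tendsto (g t)).comp (hg t ht)
  have h2 : Tendsto (fun r => U (g r) (h r - h t)) (𝓝[s] t) (𝓝 0) := by
    rw [tendsto_zero_iff_norm_tendsto_zero]
    simp_rw [hU.norm_map]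
    exact tendsto_iff_norm_sub_tendsto_zero.1 (hh t ht)
  have h3 := h1.add h2
  rw [add_zero] at h3
  exact h3.congr fun r => by rw [map_sub]; abel

theorem hasDerivAt_of_mem_domain (hU : IsPropagator A U) {x : H} (hx : x ∈ A.domain) (t : ℝ) :
    HasDerivAt (fun s => U s x) (U t (-(Complex.I • ev A x))) t := by
  have h := ((U t).restrictScalars ℝ).hasFDerivAt.comp_hasDerivAt (0 : ℝ) (hU.hasDeriv x hx)
  have h1 : HasDerivAt (fun s => U t (U (s - t) x)) (U t (-(Complex.I • ev A x))) t := by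
    have h0 : HasDerivAt (fun s => U t (U s x)) (U t (-(Complex.I • ev A x))) (t - t) := by
      rw [sub_self]; exact h
    exact h0.comp_sub_const t t
  refine h1.congr_of_eventuallyEq (.of_forall fun s => ?_)
  have := hU.add t (s - t)
  rw [add_sub_cancel] at this
  exact congrArg (fun S : H →L[ℂ] H => S x) this

/-- The orbit of `U t x` is `U t` applied to the orbit of `x`, hence differentiable at `0`, and
differentiability characterises the domain. -/
theorem apply_mem_graph (hU : IsPropagator A U) (t : ℝ) {x y : H} (h : (x, y) ∈ A.graph) :
    (U t x, U t y) ∈ A.graph := by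
  obtain ⟨hx, rfl⟩ := mem_graph_iff_ev.1 h
  have hd : HasDerivAt (fun s => U s (U t x)) (U t (-(Complex.I • ev A x))) 0 := by
    have h := ((U t).restrictScalars ℝ).hasFDerivAt.comp_hasDerivAt (0 : ℝ) (hU.hasDeriv x hx)
    refine h.congr_of_eventuallyEq (.of_forall fun s => ?_)
    have := hU.add t s
    rw [add_comm, hU.add s t] at this
    exact congrArg (fun S : H →L[ℂ] H => S x) this
  have hm := (hU.mem_domain_iff _).2 hd.differentiableAt
  refine mem_graph_iff_ev.2 ⟨hm, ?_⟩
  have e := (hU.hasDeriv _ hm).unique hd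
  rw [map_neg, neg_inj, map_smul] at e
  exact smul_right_injective H Complex.I_ne_zero e

theorem apply_mem_graphSpace (hU : IsPropagator A U) (t : ℝ) {N : ℕ} {u : Fin (N + 1) → H}
    (hu : u ∈ graphSpace A N) : (fun j => U t (u j)) ∈ graphSpace A N :=
  mem_graphSpace.2 fun j => hU.apply_mem_graph t (mem_graphSpace.1 hu j)

theorem apply_mem_domain_powOp (hU : IsPropagator A U) (t : ℝ) {N : ℕ} {x : H}
    (hx : x ∈ (powOp A N).domain) : U t x ∈ (powOp A N).domain := by
  have := mem_domain_of_mem_graphSpace (hU.apply_mem_graphSpace t (ev_powOp_mem_graphSpace hx))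
  simpa [ev_powOp_zero] using this

theorem ev_powOp_apply (hU : IsPropagator A U) (t : ℝ) {j : ℕ} {x : H}
    (hx : x ∈ (powOp A j).domain) : ev (powOp A j) (U t x) = U t (ev (powOp A j) x) := by
  have := ev_powOp_of_mem_graphSpace
    (hU.apply_mem_graphSpace t (ev_powOp_mem_graphSpace hx)) (Fin.last j)
  simpa [ev_powOp_zero] using this

/-- Product rule for a strongly continuous family of isometries applied to a differentiable
curve. -/
theorem _root_.HasDerivWithinAt.isometric_apply {V : ℝ → H →L[ℂ] H} (hn : ∀ t x, ‖V t x‖ = ‖x‖)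
    (hc : ∀ x, Continuous fun t => V t x) {w : ℝ → H} {w' y : H} {s : Set ℝ} {t : ℝ}
    (hw : HasDerivWithinAt w w' s t) (hy : HasDerivAt (fun r => V r (w t)) y t) :
    HasDerivWithinAt (fun r => V r (w r)) (y + V t w') s t := by
  rw [hasDerivWithinAt_iff_isLittleO] at hw ⊢
  -- Three errors: `V` acting on the fixed vector `w t`, the remainder of `w` (preserved in norm by
  -- `V r`), and `V r w' - V t w'`, which tends to `0` by strong continuity.
  have h1 := hasDerivWithinAt_iff_isLittleO.1 (hy.hasDerivWithinAt (s := s))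
  have h2 : (fun r => V r (w r - w t - (r - t) • w')) =o[𝓝[s] t] fun r => r - t :=
    Asymptotics.isLittleO_norm_left.1 (hw.norm_left.congr_left fun r => (hn r _).symm)
  have h3 : (fun r => (r - t) • (V r w' - V t w')) =o[𝓝[s] t] fun r => r - t := by
    have : (fun r => V r w' - V t w') =o[𝓝[s] t] fun _ => (1 : ℝ) := by
      rw [Asymptotics.isLittleO_one_iff]
      have := ((hc w').tendsto t).sub_const (V t w')
      rw [sub_self] at this
      exact this.mono_left nhdsWithin_le_nhds
    simpa using (Asymptotics.isBigO_refl (fun r => r - t) (𝓝[s] t)).smul_isLittleO this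
  refine ((h1.add h2).add h3).congr_left fun r => ?_
  have e : V r ((r - t) • w') = (r - t) • V r w' := ((V r).restrictScalars ℝ).map_smul _ _
  rw [map_sub, map_sub, e, smul_add, smul_sub]
  abel

end IsPropagator

end Propagator

/-! ### Seminorm estimates for the nonlinearity plus potential. -/

section Field

variable {H : Type*} [NormedAddCommGroup H] [InnerProductSpace ℂ H] {A : H →ₗ.[ℂ] H}
  {N : ℕ} {F : H → H}

/-- A nonlinear map of `D(A ^ N)` to itself that is Lipschitz in each seminorm `‖A ^ j ·‖` on the
sets where the seminorms up to order `j` are bounded, and that is linearly bounded in each such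
seminorm on the sets where the lower ones are. -/
structure IsTameField (A : H →ₗ.[ℂ] H) (N : ℕ) (F : H → H) : Prop where
  mapsTo : ∀ φ ∈ (powOp A N).domain, F φ ∈ (powOp A N).domain
  lipschitz : ∀ j ≤ N, ∀ R : ℝ, ∃ K : ℝ, 0 ≤ K ∧
    ∀ φ ∈ (powOp A N).domain, ∀ ψ ∈ (powOp A N).domain,
      (∀ k ≤ j, ‖ev (powOp A k) φ‖ ≤ R) → (∀ k ≤ j, ‖ev (powOp A k) ψ‖ ≤ R) →
        ‖ev (powOp A j) (F φ) - ev (powOp A j) (F ψ)‖ ≤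
          K * ‖ev (powOp A j) φ - ev (powOp A j) ψ‖
  -- Truncated subtraction matters: for `j = 0` the constant may depend on `‖φ‖` itself, for `j ≥ 1`
  -- only on orders below `j`.
  growth : ∀ j ≤ N, ∀ R : ℝ, ∃ K : ℝ, ∀ φ ∈ (powOp A N).domain,
    (∀ k ≤ j - 1, ‖ev (powOp A k) φ‖ ≤ R) →
      ‖ev (powOp A j) (F φ)‖ ≤ K * ‖ev (powOp A j) φ‖

theorem IsAdmissibleNonlinearity.isTameField_add {J : H → H} (hJ : IsAdmissibleNonlinearity A N J)
    {B : H →L[ℂ] H} (hB : IsAdmissiblePotential A N B) :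
    IsTameField A N (fun φ => J φ + B φ) where
  mapsTo φ hφ := add_mem (hJ.mapsTo N le_rfl φ hφ) (hB.mapsTo N le_rfl φ hφ)
  lipschitz j hj R := by
    obtain ⟨C, hC, hJC⟩ := hJ.lipschitz j hj
    obtain ⟨K, hK⟩ := hB.bound j hj
    refine ⟨|C (fun _ => R, fun _ => R)| + |K|, by positivity, fun φ hφ ψ hψ hφR hψR => ?_⟩
    have hd := @domain_powOp_antitone H _ _ A j N hj
    have h1 := hJC φ hφ ψ hψ
    have h2 := hK (φ - ψ) (sub_mem hφ hψ)
    have hJφ := hd (hJ.mapsTo N le_rfl φ hφ)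
    have hJψ := hd (hJ.mapsTo N le_rfl ψ hψ)
    have hBφ := hd (hB.mapsTo N le_rfl φ hφ)
    have hBψ := hd (hB.mapsTo N le_rfl ψ hψ)
    rw [ev_sub hJφ hJψ, ev_sub (hd hφ) (hd hψ)] at h1
    rw [map_sub, ev_sub hBφ hBψ, ev_sub (hd hφ) (hd hψ)] at h2
    have hCR : C (fun k => ‖ev (powOp A k) φ‖, fun k => ‖ev (powOp A k) ψ‖) ≤
        |C (fun _ => R, fun _ => R)| :=
      (hC ⟨fun k => hφR k (Nat.lt_succ_iff.1 k.2), fun k => hψR k (Nat.lt_succ_iff.1 k.2)⟩).trans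
        (le_abs_self _)
    rw [ev_add hJφ hBφ, ev_add hJψ hBψ, add_sub_add_comm, add_mul]
    refine (norm_add_le _ _).trans (add_le_add (h1.trans ?_) (h2.trans ?_))
    · gcongr
    · gcongr; exact le_abs_self K
  growth j hj R := by
    have hJ' : ∃ C : ℝ, ∀ φ ∈ (powOp A N).domain, (∀ k ≤ j - 1, ‖ev (powOp A k) φ‖ ≤ R) →
        ‖ev (powOp A j) (J φ)‖ ≤ C * ‖ev (powOp A j) φ‖ := by
      rcases Nat.eq_zero_or_pos j with rfl | hj0
      · obtain ⟨C, hC, h⟩ := hJ.growth_zero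
        refine ⟨C R, fun φ hφ hR => ?_⟩
        have hR0 := hR 0 le_rfl
        rw [ev_powOp_zero] at hR0 ⊢
        rw [ev_powOp_zero]
        exact (h φ hφ).trans (by gcongr; exact hC hR0)
      · obtain ⟨C, hC, h⟩ := hJ.growth j hj0 hj
        refine ⟨C fun _ => R, fun φ hφ hR => (h φ hφ).trans ?_⟩
        gcongr
        exact hC fun k => hR k (Nat.le_sub_one_of_lt k.2)
    obtain ⟨C, hC⟩ := hJ'
    obtain ⟨K, hK⟩ := hB.bound j hj
    refine ⟨C + K, fun φ hφ hR => ?_⟩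
    have hd := @domain_powOp_antitone H _ _ A j N hj
    rw [ev_add (hd (hJ.mapsTo N le_rfl φ hφ)) (hd (hB.mapsTo N le_rfl φ hφ)), add_mul]
    exact (norm_add_le _ _).trans (add_le_add (hC φ hφ hR) (hK φ hφ))

theorem IsTameField.continuousOn_ev_comp (hF : IsTameField A N F) {j : ℕ} (hj : j ≤ N)
    {φ : ℝ → H} {I : Set ℝ} (hφ : ∀ t ∈ I, φ t ∈ (powOp A N).domain)
    (hc : ∀ k ≤ j, ContinuousOn (fun t => ev (powOp A k) (φ t)) I) :
    ContinuousOn (fun t => ev (powOp A j) (F (φ t))) I := by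
  intro t ht
  -- The added `1` leaves room for each seminorm to stay below `R` near `t`, so a single Lipschitz
  -- constant applies there.
  let R : ℝ := ∑ k ∈ Finset.range (j + 1), (‖ev (powOp A k) (φ t)‖ + 1)
  have hR : ∀ k ≤ j, ‖ev (powOp A k) (φ t)‖ + 1 ≤ R := fun k hk =>
    Finset.single_le_sum (f := fun k => ‖ev (powOp A k) (φ t)‖ + 1) (fun _ _ => by positivity)
      (Finset.mem_range.2 (Nat.lt_succ_of_le hk))
  obtain ⟨K, hK0, hK⟩ := hF.lipschitz j hj R
  have hev : ∀ᶠ s in 𝓝[I] t, ∀ k ∈ Finset.range (j + 1), ‖ev (powOp A k) (φ s)‖ ≤ R := by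
    refine (Finset.eventually_all _).2 fun k hk => ?_
    have hk' := Nat.lt_succ_iff.1 (Finset.mem_range.1 hk)
    exact ((hc k hk' t ht).norm.eventually_lt_const
      (by linarith [hR k hk'] : ‖ev (powOp A k) (φ t)‖ < R)).mono fun _ h => h.le
  refine tendsto_iff_norm_sub_tendsto_zero.2 ?_
  have hlim : Tendsto (fun s => K * ‖ev (powOp A j) (φ s) - ev (powOp A j) (φ t)‖) (𝓝[I] t)
      (𝓝 0) := by
    simpa using (tendsto_iff_norm_sub_tendsto_zero.1 (hc j le_rfl t ht)).const_mul K
  refine squeeze_zero' (.of_forall fun _ => norm_nonneg _) ?_ hlim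
  filter_upwards [hev, self_mem_nhdsWithin] with s hs hsI
  exact hK _ (hφ s hsI) _ (hφ t ht)
    (fun k hk => hs k (Finset.mem_range.2 (Nat.lt_succ_of_le hk)))
    (fun k hk => by linarith [hR k hk])

end Field

/-! ### The interaction picture. -/

section Interaction

variable {H : Type*} [NormedAddCommGroup H] [InnerProductSpace ℂ H] {A : H →ₗ.[ℂ] H}
  {N : ℕ} {F : H → H} {U : ℝ → H →L[ℂ] H}

/-- The vector field of the equation in the interaction picture, on `D(A ^ N)`. -/
def interactionField (hF : IsTameField A N F) (hU : IsPropagator A U) (t : ℝ)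
    (v : graphSpace A N) : graphSpace A N :=
  ⟨fun j => U (-t) (ev (powOp A j) (F (U t (v.1 0)))), hU.apply_mem_graphSpace (-t)
    (ev_powOp_mem_graphSpace (hF.mapsTo _
      (hU.apply_mem_domain_powOp t (mem_domain_of_mem_graphSpace v.2))))⟩

theorem norm_apply_le_of_graphSpace (v : graphSpace A N) (j : Fin (N + 1)) : ‖v.1 j‖ ≤ ‖v‖ :=
  norm_le_pi_norm v.1 j

theorem ev_powOp_propagator_graphSpace (hU : IsPropagator A U) (t : ℝ) (v : graphSpace A N)
    {j : ℕ} (hj : j ≤ N) :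
    ev (powOp A j) (U t (v.1 0)) = U t (v.1 ⟨j, Nat.lt_succ_of_le hj⟩) := by
  rw [hU.ev_powOp_apply t (domain_powOp_antitone hj (mem_domain_of_mem_graphSpace v.2))]
  exact congrArg _ (ev_powOp_of_mem_graphSpace v.2 ⟨j, Nat.lt_succ_of_le hj⟩)

theorem continuous_interactionField (hF : IsTameField A N F) (hU : IsPropagator A U)
    (v : graphSpace A N) : Continuous fun t => interactionField hF hU t v := by
  refine Continuous.subtype_mk (continuous_pi fun j => ?_) _
  rw [← continuousOn_univ]
  refine hU.continuousOn_apply continuous_neg.continuousOn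
    (hF.continuousOn_ev_comp (Nat.lt_succ_iff.1 j.2)
      (fun t _ => hU.apply_mem_domain_powOp t (mem_domain_of_mem_graphSpace v.2)) fun k hk => ?_)
  simp_rw [ev_powOp_propagator_graphSpace hU _ v (hk.trans (Nat.lt_succ_iff.1 j.2))]
  exact (hU.continuous _).continuousOn

/-- Conjugation by the group preserves every seminorm `‖A^j ·‖`, so the constants of `F` serve at
all times. -/
theorem lipschitzOnWith_interactionField (hF : IsTameField A N F) (hU : IsPropagator A U) (R : ℝ) :
    ∃ K, ∀ t, LipschitzOnWith K (interactionField hF hU t) (Metric.closedBall 0 R) := by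
  choose K hK0 hK using fun j : Fin (N + 1) => hF.lipschitz j (Nat.lt_succ_iff.1 j.2) R
  have hsum : 0 ≤ ∑ j, K j := Finset.sum_nonneg fun j _ => hK0 j
  refine ⟨⟨∑ j, K j, hsum⟩, fun t => LipschitzOnWith.of_dist_le_mul fun v hv w hw => ?_⟩
  rw [mem_closedBall_zero_iff] at hv hw
  rw [dist_eq_norm, dist_eq_norm]
  refine (pi_norm_le_iff_of_nonneg (by positivity)).2 fun j => ?_
  have hj := Nat.lt_succ_iff.1 j.2
  have hb : ∀ u : graphSpace A N, ‖u‖ ≤ R → ∀ k ≤ (j : ℕ), ‖ev (powOp A k) (U t (u.1 0))‖ ≤ R :=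
    fun u hu k hk => by
      rw [ev_powOp_propagator_graphSpace hU t u (hk.trans hj), hU.norm_map]
      exact (norm_apply_le_of_graphSpace u _).trans hu
  have hdom : ∀ u : graphSpace A N, U t (u.1 0) ∈ (powOp A N).domain := fun u =>
    hU.apply_mem_domain_powOp t (mem_domain_of_mem_graphSpace u.2)
  have h := hK j _ (hdom v) _ (hdom w) (hb v hv) (hb w hw)
  rw [ev_powOp_propagator_graphSpace hU t v hj, ev_powOp_propagator_graphSpace hU t w hj, ← map_sub,
    hU.norm_map] at h
  change ‖U (-t) _ - U (-t) _‖ ≤ _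
  rw [← map_sub, hU.norm_map]
  refine h.trans (mul_le_mul ?_ (norm_apply_le_of_graphSpace (v - w) j) (norm_nonneg _) hsum)
  exact Finset.single_le_sum (f := K) (fun i _ => hK0 i) (Finset.mem_univ j)

theorem hasDerivWithinAt_graphSpace_apply {v : ℝ → graphSpace A N} {v' : graphSpace A N}
    {I : Set ℝ} {t : ℝ} (h : HasDerivWithinAt v v' I t) (j : Fin (N + 1)) :
    HasDerivWithinAt (fun s => (v s).1 j) (v'.1 j) I t := by
  have h1 := ((graphSpace A N).subtypeL.restrictScalars ℝ).hasFDerivAt.comp_hasDerivWithinAt t h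
  exact hasDerivWithinAt_pi.1 h1 j

end Interaction

/-! ### Strong solutions: existence, uniqueness, a priori bounds, mild form. -/

section StrongSolution

variable {H : Type*} [NormedAddCommGroup H] [InnerProductSpace ℂ H] {A : H →ₗ.[ℂ] H}
  {N : ℕ} {J : H → H} {B : H →L[ℂ] H} {U : ℝ → H →L[ℂ] H} {φ₀ : H}

theorem isStrongSolution_of_isIntegralCurveOn (hN : 1 ≤ N)
    (hF : IsTameField A N fun φ => J φ + B φ) (hU : IsPropagator A U) {v : ℝ → graphSpace A N}
    (hv0 : (v 0).1 0 = φ₀) {I : Set ℝ} (hv : IsIntegralCurveOn v (interactionField hF hU) I) :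
    IsStrongSolution A N J B φ₀ I fun t => U t ((v t).1 0) where
  init := by simp [hU.zero, hv0]
  mem_domain t _ := hU.apply_mem_domain_powOp t (mem_domain_of_mem_graphSpace (v t).2)
  continuousOn j hj := by
    simp_rw [fun t => ev_powOp_propagator_graphSpace hU t (v t) hj]
    exact hU.continuousOn_apply continuousOn_id fun t ht =>
      (hasDerivWithinAt_graphSpace_apply (hv t ht) _).continuousWithinAt
  hasDeriv t ht := by
    have hx := mem_domain_of_mem_domain_powOp hN (mem_domain_of_mem_graphSpace (v t).2)
    have h := (hasDerivWithinAt_graphSpace_apply (hv t ht) 0).isometric_apply hU.norm_map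
      hU.continuous (hU.hasDerivAt_of_mem_domain hx t)
    convert h using 1
    have e : (interactionField hF hU t (v t)).1 0 =
        U (-t) (J (U t ((v t).1 0)) + B (U t ((v t).1 0))) :=
      congrArg (U (-t)) (ev_powOp_zero _)
    rw [e, hU.apply_neg_apply, map_neg, map_smul, add_assoc,
      ev_eq_of_mem_graph (hU.apply_mem_graph t (mem_graph_ev hx))]

/-- The terms in `A φ` cancel in the product rule. The curve lives in `H`, not in `graphSpace`,
since a strong solution is differentiable only in `H`. -/
theorem IsStrongSolution.isIntegralCurveOn (hN : 1 ≤ N) (hU : IsPropagator A U) {I : Set ℝ}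
    {φ : ℝ → H} (hφ : IsStrongSolution A N J B φ₀ I φ) :
    IsIntegralCurveOn (fun t => U (-t) (φ t))
      (fun t x => U (-t) (J (U t x) + B (U t x))) I := by
  intro t ht
  have hx := mem_domain_of_mem_domain_powOp hN (hφ.mem_domain t ht)
  have hd : HasDerivAt (fun s => U (-s) (φ t)) (-(U (-t) (-(Complex.I • ev A (φ t))))) t := by
    have := HasDerivAt.scomp t (h := fun s : ℝ => -s) (hU.hasDerivAt_of_mem_domain hx (-t))
      (hasDerivAt_neg t)
    simpa [Function.comp_def] using this
  have h := (hφ.hasDeriv t ht).isometric_apply (V := fun s => U (-s)) (fun s => hU.norm_map (-s))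
    (fun x => (hU.continuous x).comp continuous_neg) hd
  convert h using 1
  simp only [hU.apply_neg_apply, ← map_neg, ← map_add]
  congr 1
  abel

theorem IsStrongSolution.mono {I I' : Set ℝ} {φ : ℝ → H}
    (hφ : IsStrongSolution A N J B φ₀ I φ) (h : I' ⊆ I) : IsStrongSolution A N J B φ₀ I' φ where
  init := hφ.init
  mem_domain t ht := hφ.mem_domain t (h ht)
  continuousOn j hj := (hφ.continuousOn j hj).mono h
  hasDeriv t ht := (hφ.hasDeriv t (h ht)).mono h

theorem IsStrongSolution.eqOn (hN : 1 ≤ N) (hF : IsTameField A N fun φ => J φ + B φ)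
    (hU : IsPropagator A U) {T : ℝ} {φ ψ : ℝ → H}
    (hφ : IsStrongSolution A N J B φ₀ (Set.Ico 0 T) φ)
    (hψ : IsStrongSolution A N J B φ₀ (Set.Ico 0 T) ψ) : Set.EqOn φ ψ (Set.Ico 0 T) := by
  -- The estimate of order `0` involves only the norm of `H` but holds only on `D(A^N)`, hence the
  -- intersection.
  have hlip : ∀ R, ∃ K, ∀ t, LipschitzOnWith K (fun x => U (-t) (J (U t x) + B (U t x)))
      (((powOp A N).domain : Set H) ∩ Metric.closedBall 0 R) := by
    intro R
    obtain ⟨K, hK0, hK⟩ := hF.lipschitz 0 (Nat.zero_le _) R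
    refine ⟨⟨K, hK0⟩, fun t => LipschitzOnWith.of_dist_le_mul fun x hx y hy => ?_⟩
    have hb : ∀ z ∈ Metric.closedBall (0 : H) R, ∀ k ≤ 0, ‖ev (powOp A k) (U t z)‖ ≤ R := by
      intro z hz k hk
      obtain rfl := Nat.le_zero.1 hk
      rw [ev_powOp_zero, hU.norm_map]
      exact mem_closedBall_zero_iff.1 hz
    have h := hK _ (hU.apply_mem_domain_powOp t hx.1) _ (hU.apply_mem_domain_powOp t hy.1)
      (hb x hx.2) (hb y hy.2)
    simp only [ev_powOp_zero] at h
    rw [← map_sub, hU.norm_map] at h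
    rw [dist_eq_norm, dist_eq_norm, ← map_sub, hU.norm_map]
    exact h
  have h := eqOn_of_isIntegralCurveOn_Ico hlip (hφ.isIntegralCurveOn hN hU)
    (fun t ht => hU.apply_mem_domain_powOp _ (hφ.mem_domain t ht)) (hψ.isIntegralCurveOn hN hU)
    (fun t ht => hU.apply_mem_domain_powOp _ (hψ.mem_domain t ht)) (by simp [hφ.init, hψ.init])
  intro t ht
  have := congrArg (U t) (h ht)
  simpa only [hU.apply_neg_apply] using this

/-- A bound for the solution in `H` gives a bound in `D(A ^ N)`, by Gronwall's inequality in each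
of the seminorms `‖A ^ j ·‖` in turn. -/
theorem exists_bound_of_isIntegralCurveOn {F : H → H} (hF : IsTameField A N F)
    (hU : IsPropagator A U) {v : ℝ → graphSpace A N} {T M : ℝ}
    (hv : IsIntegralCurveOn v (interactionField hF hU) (Set.Ico 0 T))
    (hM : ∀ t ∈ Set.Ico 0 T, ‖(v t).1 0‖ ≤ M) : ∃ R, ∀ t ∈ Set.Ico 0 T, ‖v t‖ ≤ R := by
  have key : ∀ j : ℕ, j ≤ N → ∃ R, ∀ t ∈ Set.Ico 0 T, ∀ k : Fin (N + 1), (k : ℕ) ≤ j →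
      ‖(v t).1 k‖ ≤ R := by
    intro j
    induction j with
    | zero =>
      refine fun _ => ⟨M, fun t ht k hk => ?_⟩
      obtain rfl : k = 0 := Fin.ext (Nat.le_zero.1 hk)
      exact hM t ht
    | succ j ih =>
      intro hj
      obtain ⟨R, hR⟩ := ih (by omega)
      -- Orders up to `j` are already bounded by `R`, so `K` is constant along the curve and the
      -- inequality at order `j + 1` is linear.
      obtain ⟨K, hK⟩ := hF.growth (j + 1) hj R
      let j' : Fin (N + 1) := ⟨j + 1, Nat.lt_succ_of_le hj⟩
      have hd : ∀ t ∈ Set.Ico 0 T, ‖(interactionField hF hU t (v t)).1 j'‖ ≤ K * ‖(v t).1 j'‖ := by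
        intro t ht
        change ‖U (-t) (ev (powOp A (j + 1)) (F (U t ((v t).1 0))))‖ ≤ _
        rw [hU.norm_map]
        refine (hK _ (hU.apply_mem_domain_powOp t (mem_domain_of_mem_graphSpace (v t).2))
          fun k hk => ?_).trans_eq ?_
        · rw [ev_powOp_propagator_graphSpace hU t (v t) (by omega), hU.norm_map]
          exact hR t ht _ (by simpa using hk)
        · rw [ev_powOp_propagator_graphSpace hU t (v t) hj, hU.norm_map]
      refine ⟨max R (‖(v 0).1 j'‖ * Real.exp (|K| * T)), fun t ht k hk => ?_⟩
      rcases Nat.lt_or_ge k (j + 1) with hlt | hge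
      · exact (hR t ht k (by omega)).trans (le_max_left _ _)
      obtain rfl : k = j' := Fin.ext (le_antisymm hk hge)
      refine le_trans ?_ (le_max_right _ _)
      have hsub : Set.Icc 0 t ⊆ Set.Ico 0 T := fun s hs => ⟨hs.1, hs.2.trans_lt ht.2⟩
      have hg := norm_le_gronwallBound_of_norm_deriv_right_le (f := fun s => (v s).1 j')
        (f' := fun s => (interactionField hF hU s (v s)).1 j') (δ := ‖(v 0).1 j'‖) (K := K)
        (ε := 0) (a := 0) (b := t)
        (fun s hs => (hasDerivWithinAt_graphSpace_apply
          (hv s (hsub hs)) j').continuousWithinAt.mono hsub)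
        (fun s hs => (hasDerivWithinAt_graphSpace_apply
          (hv s (hsub ⟨hs.1, hs.2.le⟩)) j').of_Ico (hs.2.trans ht.2) (Set.Ici_subset_Ici.2 hs.1))
        le_rfl (fun s hs => by rw [add_zero]; exact hd s (hsub ⟨hs.1, hs.2.le⟩)) t
        ⟨ht.1, le_rfl⟩
      rw [gronwallBound_ε0, sub_zero] at hg
      refine hg.trans ?_
      have h1 : K * t ≤ |K| * T :=
        mul_le_mul (le_abs_self K) ht.2.le ht.1 (abs_nonneg K)
      gcongr
  obtain ⟨R, hR⟩ := key N le_rfl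
  refine ⟨|R|, fun t ht => (pi_norm_le_iff_of_nonneg (abs_nonneg R)).2 fun k => ?_⟩
  exact (hR t ht k (Nat.lt_succ_iff.1 k.2)).trans (le_abs_self R)

theorem IsStrongSolution.isMildSolution [CompleteSpace H] (hN : 1 ≤ N)
    (hF : IsTameField A N fun φ => J φ + B φ) (hU : IsPropagator A U) {φ : ℝ → H}
    (hφ : IsStrongSolution A N J B φ₀ (Set.Ici 0) φ) :
    IsMildSolution A J B φ₀ (Set.Ici 0) φ := by
  refine ⟨U, hU, fun t ht => ?_⟩
  have hc : ContinuousOn φ (Set.Ici 0) := fun s hs => (hφ.hasDeriv s hs).continuousWithinAt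
  have hBc : ContinuousOn (fun s => B (φ s)) (Set.Ici 0) := B.continuous.comp_continuousOn hc
  have hFc : ContinuousOn (fun s => J (φ s) + B (φ s)) (Set.Ici 0) := by
    have := hF.continuousOn_ev_comp (Nat.zero_le N) hφ.mem_domain
      (fun k hk => hφ.continuousOn k (hk.trans (Nat.zero_le N)))
    simpa only [ev_powOp_zero] using this
  -- Tameness gives continuity of the sum; subtracting the bounded part isolates `J`.
  have hJc : ContinuousOn (fun s => J (φ s)) (Set.Ici 0) :=
    (hFc.sub hBc).congr fun s _ => by simp
  have hsub : Set.uIcc 0 t ⊆ Set.Ici 0 := by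
    rw [Set.uIcc_of_le ht]; exact Set.Icc_subset_Ici_self
  have hint : ∀ (τ : ℝ → ℝ) (h : ℝ → H), Continuous τ → ContinuousOn h (Set.Ici 0) →
      IntervalIntegrable (fun s => U (τ s) (h s)) MeasureTheory.volume 0 t := fun τ h hτ hh =>
    ((hU.continuousOn_apply hτ.continuousOn hh).mono hsub).intervalIntegrable
  have hJi := hint (fun s => t - s) _ (by fun_prop) hJc
  have hBi := hint (fun s => t - s) _ (by fun_prop) hBc
  refine ⟨hJi, hBi, ?_⟩
  have hcurve := hφ.isIntegralCurveOn hN hU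
  have hd : ∀ s ∈ Set.Ici (0 : ℝ), HasDerivWithinAt (fun s => U (-s) (φ s))
      (U (-s) (J (φ s) + B (φ s))) (Set.Ici 0) s := fun s hs => by
    simpa only [hU.apply_neg_apply] using hcurve s hs
  have hFi := hint (fun s => -s) _ continuous_neg hFc
  -- Integrating the interaction-picture equation and then applying `U t` yields Duhamel's formula.
  have hFTC := intervalIntegral.integral_eq_sub_of_hasDeriv_right
    (f := fun s => U (-s) (φ s)) (fun s hs => (hd s (hsub hs)).continuousWithinAt.mono hsub)
    (fun s hs => by
      rw [min_eq_left ht] at hs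
      exact (hd s hs.1.le).mono fun r hr => hs.1.le.trans (le_of_lt hr)) hFi
  have h0 : U (-0) (φ 0) = φ₀ := by simp [hφ.init, hU.zero]
  rw [h0] at hFTC
  have h1 := congrArg (U t) hFTC
  rw [map_sub, hU.apply_neg_apply, ← ContinuousLinearMap.intervalIntegral_comp_comm _ hFi] at h1
  have h2 : ∀ s, U t (U (-s) (J (φ s) + B (φ s))) = U (t - s) (J (φ s)) + U (t - s) (B (φ s)) := by
    intro s
    rw [← map_add, sub_eq_add_neg, hU.add]
    rfl
  simp_rw [h2] at h1
  rw [intervalIntegral.integral_add hJi hBi] at h1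
  rw [add_assoc, h1]
  abel

end StrongSolution

end SemilinearEvolution

end

theorem theorem2p7
    {H : Type*} [NormedAddCommGroup H] [InnerProductSpace ℂ H] [CompleteSpace H]
    {E : Type*} [AddCommGroup E] [Module ℂ E]
    (A : H →ₗ.[ℂ] H) (hA : IsSelfAdjoint A)
    (N : ℕ) (hN : 1 ≤ N)
    (J : H → H) (hJ : SemilinearEvolution.IsAdmissibleNonlinearity A N J)
    (Θ : E → H →L[ℂ] H) (ζ η : E) (z : ℂ)
    (hΘ : SemilinearEvolution.IsAdmissiblePotential A N (Θ (ζ + z • η)))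
    (φ₀ : H) (hφ₀ : φ₀ ∈ (SemilinearEvolution.powOp A N).domain)
    (hbdd : ∀ T : ℝ, 0 < T → ∀ φ : ℝ → H,
      SemilinearEvolution.IsStrongSolution A N J (Θ (ζ + z • η)) φ₀ (Set.Ico 0 T) φ →
        ∃ M : ℝ, ∀ t ∈ Set.Ico 0 T, ‖φ t‖ ≤ M) :
    ∃ φ : ℝ → H,
      SemilinearEvolution.IsStrongSolution A N J (Θ (ζ + z • η)) φ₀ (Set.Ici 0) φ ∧
      SemilinearEvolution.IsMildSolution A J (Θ (ζ + z • η)) φ₀ (Set.Ici 0) φ ∧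
      ∀ T : ℝ, 0 < T → ∀ ψ : ℝ → H,
        SemilinearEvolution.IsStrongSolution A N J (Θ (ζ + z • η)) φ₀ (Set.Ico 0 T) ψ →
          Set.EqOn ψ φ (Set.Ico 0 T) := by
  open SemilinearEvolution in
  obtain ⟨U, hU⟩ := exists_isPropagator hA
  have hF := hJ.isTameField_add hΘ
  have hcomplete : CompleteSpace (graphSpace A N) :=
    (isClosed_graphSpace hA.isClosed N).completeSpace_coe
  let u₀ : graphSpace A N := ⟨_, ev_powOp_mem_graphSpace hφ₀⟩
  have hu₀ : u₀.1 0 = φ₀ := ev_powOp_zero φ₀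
  obtain ⟨v, hv0, hv⟩ := exists_isIntegralCurveOn_Ici_of_bounded
    (continuous_interactionField hF hU) (lipschitzOnWith_interactionField hF hU) u₀
    fun T hT w hw0 hw => by
      obtain ⟨M, hM⟩ := hbdd T hT _
        (isStrongSolution_of_isIntegralCurveOn hN hF hU (by rw [hw0, hu₀]) hw)
      -- The assumed bound is on `U t` applied to component `0` of `w t`; isometry transfers it to
      -- that component.
      exact exists_bound_of_isIntegralCurveOn hF hU hw fun t ht =>
        (hU.norm_map t _).symm.trans_le (hM t ht)
  have hφ := isStrongSolution_of_isIntegralCurveOn hN hF hU (φ₀ := φ₀) (by rw [hv0, hu₀]) hv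
  exact ⟨_, hφ, hφ.isMildSolution hN hF hU, fun T _ ψ hψ =>
    hψ.eqOn hN hF hU (hφ.mono Set.Ico_subset_Ici_self)⟩
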